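/- Let $x$ be a root of unity, let $a,b\in\mathbb{C}\setminus\mathbb{Z}$ and $q\in\mathbb{N}=\{1,2,3,\dots\}$ with $b-a\notin\mathbb{N}$, $2(b-a)\notin\mathbb{N}$ and $(q,x)\neq(1,1)$. Notation. $\binom{z}{w}=\frac{\Gamma(z+1)}{\Gamma(w+1)\Gamma(z-w+1)}$, and $\binom{2n+2a}{n+a}^{-1}$ is read as $0$ when $2n+2a$ is a negative integer. For $p\in\mathbb{N}$, $c\in\mathbb{C}\setminus\mathbb{Z}$ and $x$ a root of unity with $(p,x)\neq(1,1)$, $\mathrm{Li}_p(x;c)=\sum_{n=1}^\infty \frac{x^n}{(n+c-1)^p}$ is the cyclotomic Hurwitz zeta function. Put $$\Lambda_k(x;c)=x\,\mathrm{Li}_{k+1}(x^{-1};c)-(-1)^k\,\mathrm{Li}_{k+1}(x;1-c)\qquad(k\ge 0),$$ where for $k=0$, $x=1$ the difference is taken term by term: $\Lambda_0(1;c)=\sum_{n=1}^\infty\left(\frac1{n+c-1}-\frac1{n-c}\right)$. Let $\psi=\Gamma'/\Gamma$ be the digamma function, $\gamma$ Euler's constant, and let $Y_n$ be the exponential complete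 Bell polynomials, $\exp\left(\sum_{k\ge1}u_k\frac{t^k}{k!}\right)=\sum_{n\ge0}Y_n(u_1,\dots,u_n)\frac{t^n}{n!}$. Set $$C_n(z)=\Gamma(z+1)\,Y_n\left(\psi(z+1)+\gamma,\psi^{(1)}(z+1),\psi^{(2)}(z+1),\dots,\psi^{(n-1)}(z+1)\right),$$ $$D_n(z)=\frac{1}{\Gamma(z+1)}\,Y_n\left(-\psi(z+1)-\gamma,-\psi^{(1)}(z+1),-\psi^{(2)}(z+1),\dots,-\psi^{(n-1)}(z+1)\right).$$ Theorem. All the series below and in the definitions above converge (for $q=1$ possibly only conditionally; the two ends of the bilateral series converge separately), and $$\sum_{n=-\infty}^\infty \frac{4^{n+a}}{(n+b)^q\binom{2n+2a}{n+a}}x^{-n}-(-1)^q\left(-\Lambda_0(x;a)\right)\sum_{n=1}^\infty\frac{n\binom{2n}{n}}{(n+a-b)^q4^n}x^n$$ $$=4^{a-b}\sum_{\substack{k_1+\cdots+k_5=q-1\\ k_j\ge0}}\frac{C_{k_1}(a-b)\,C_{k_2}(a-b)\,D_{k_3}(2a-2b)\,2^{k_3+k_4}}{k_1!\,k_2!\,k_3!\,k_4!}\,\log^{k_4}(2)\,\Lambda_{k_5}(x;b).$$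 Here, for $x\ne1$, $-\Lambda_0(x;a)=\mathrm{Li}_1(x;1-a)-x\,\mathrm{Li}_1(x^{-1};a)$. -/

import Mathlib

open Filter Topology

noncomputable section

namespace AperyLike

/-- The `N`-th partial sum `∑_{n=1}^N f n` of a series over the positive integers. -/
def partialSum (f : ℕ → ℂ) (N : ℕ) : ℂ := ∑ n ∈ Finset.Icc 1 N, f n

/-- Convergence (possibly only conditional) of `∑_{n=1}^∞ f n`. -/
def SeriesConverges (f : ℕ → ℂ) : Prop :=
  ∃ S : ℂ, Tendsto (partialSum f) atTop (𝓝 S)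

/-- The value of `∑_{n=1}^∞ f n`: the limit of the partial sums
(meaningful when `SeriesConverges f`). -/
def seriesValue (f : ℕ → ℂ) : ℂ := limUnder atTop (partialSum f)

/-- The partial sum `∑_{n=-M}^N f n` of a series over all integers. -/
def bilateralPartialSum (f : ℤ → ℂ) (p : ℕ × ℕ) : ℂ :=
  ∑ n ∈ Finset.Icc (-(p.1 : ℤ)) (p.2 : ℤ), f n

/-- Convergence (possibly only conditional) of `∑_{n=-∞}^∞ f n`, where the lower and upper limits
of summation tend to infinity independently of each other. -/
def BilateralConverges (f : ℤ → ℂ) : Prop :=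
  ∃ S : ℂ, Tendsto (bilateralPartialSum f) atTop (𝓝 S)

/-- The value of `∑_{n=-∞}^∞ f n` (meaningful when `BilateralConverges f`). -/
def bilateralValue (f : ℤ → ℂ) : ℂ := limUnder atTop (bilateralPartialSum f)

/-- The generalized binomial coefficient `Γ(z+1) / (Γ(w+1) Γ(z-w+1))`. The value of `Γ` at its
poles being `0` here, `(genBinom z w)⁻¹ = 0` when `z` is a negative integer. -/
def genBinom (z w : ℂ) : ℂ :=
  Complex.Gamma (z + 1) / (Complex.Gamma (w + 1) * Complex.Gamma (z - w + 1))

/-- The terms `4^{n+a} x^{-n} / ((n+b)^q binom(2n+2a, n+a))`. -/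
def aperyTerm (q : ℕ) (x a b : ℂ) (n : ℤ) : ℂ :=
  (4 : ℂ) ^ ((n : ℂ) + a) / (((n : ℂ) + b) ^ q * genBinom (2 * n + 2 * a) (n + a)) * x ^ (-n)

/-- The terms `n binom(2n, n) x^n / ((n+c)^q 4^n)`. -/
def centralBinomTerm (q : ℕ) (x c : ℂ) (n : ℕ) : ℂ :=
  (n : ℂ) * ((2 * n).choose n : ℂ) / (((n : ℂ) + c) ^ q * 4 ^ n) * x ^ n

/-- The terms `x^n / (n+c-1)^p` of the cyclotomic Hurwitz zeta function `Li_p(x;c)`. -/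
def hurwitzTerm (p : ℕ) (x c : ℂ) (n : ℕ) : ℂ := x ^ n / ((n : ℂ) + c - 1) ^ p

/-- The cyclotomic Hurwitz zeta function `Li_p(x;c) = ∑_{n=1}^∞ x^n / (n+c-1)^p`. -/
def cycHurwitz (p : ℕ) (x c : ℂ) : ℂ := seriesValue (hurwitzTerm p x c)

/-- The combination `x Li_{k+1}(x⁻¹;c) - (-1)^k Li_{k+1}(x;1-c)`. In the single case `k = 0`,
`x = 1`, where the two series diverge separately, it is
`∑_{n=1}^∞ (1/(n+c-1) - 1/(n-c))`, the difference being taken term by term. -/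
def cycHurwitzPair (k : ℕ) (x c : ℂ) : ℂ :=
  open Classical in
  if k = 0 ∧ x = 1 then
    seriesValue (fun n => hurwitzTerm 1 1 c n - hurwitzTerm 1 1 (1 - c) n)
  else x * cycHurwitz (k + 1) x⁻¹ c - (-1) ^ k * cycHurwitz (k + 1) x (1 - c)

/-- The exponential complete Bell polynomial `Y_n(u_1, ..., u_n)`, given by its recurrence
`Y_0 = 1`, `Y_{n+1} = ∑_{j=0}^{n} binom(n, j) u_{n+1-j} Y_j` (`u 0` is not used). -/
def bellY (u : ℕ → ℂ) : ℕ → ℂ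
  | 0 => 1
  | n + 1 => ∑ j : Fin (n + 1), (n.choose j : ℂ) * u (n + 1 - j) * bellY u j
termination_by n => n
decreasing_by exact j.isLt

/-- The sequence `ψ(z+1) + γ, ψ^{(1)}(z+1), ψ^{(2)}(z+1), ...`, indexed from `1`. -/
def polygammaSeq (z : ℂ) (k : ℕ) : ℂ :=
  iteratedDeriv (k - 1) Complex.digamma (z + 1) +
    if k = 1 then (Real.eulerMascheroniConstant : ℂ) else 0

/-- `C_n(z) = Γ(z+1) Y_n(ψ(z+1) + γ, ψ^{(1)}(z+1), ..., ψ^{(n-1)}(z+1))`. -/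
def coeffC (n : ℕ) (z : ℂ) : ℂ := Complex.Gamma (z + 1) * bellY (polygammaSeq z) n

/-- `D_n(z) = Y_n(-ψ(z+1) - γ, -ψ^{(1)}(z+1), ..., -ψ^{(n-1)}(z+1)) / Γ(z+1)`. -/
def coeffD (n : ℕ) (z : ℂ) : ℂ :=
  bellY (fun k => -polygammaSeq z k) n / Complex.Gamma (z + 1)

end AperyLike

end

/-!
Write `d = a - b`, and let `β k = binom(2k, k) / 4^k` (`centralCoeff`). By the duplication formula

  `G(z) = 4^z / binom(2z, z) = √π Γ(z + 1) / Γ(z + 1/2) = z B(z, 1/2)`,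

and expanding `(1 - t)^(-1/2)` in the Beta integral gives the partial fraction series `G(z) = 1 +
∑_{k ≥ 1} β k z / (z + k)` for `Re z > 0` (`hasSum_betaIntegral_half`); both sides satisfy the
same recurrence in `z`, which extends the formula to all `z` off the negative integers
(`recipSeries_eq`).

Put `u = n + b`, so that `n + a = d + u`. Taylor's formula at `d`, applied to each partial
fraction, reads (`recipSeries_taylor`)

  `G(n + a) / u^q = ∑_{j < q} g_j / u^(q-j) - (-1)^q ∑_k e_k / (n + a + k)`,
  `e_k = k β k / (k + d)^q`,

where the `g_j` are the Taylor coefficients of `G` at `d`. Multiply by `x^(-n)` and sum over all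
`n`. Since `Λ_k(x; c) = ∑_n x^(-n) / (n + c)^(k+1)` (`tendsto_pairTerm`), the first part gives
`∑_j g_j Λ_{q-1-j}(x; b)`. In the second part the shift by `k` turns the inner sum over `n` into
`x^k Λ_0(x; a)`, which gives the product of `Λ_0(x; a)` with the central binomial series. The
coefficients `g_j` are computed from the product `G(z) = 4^z Γ(z+1)^2 / Γ(2z+1)`, the derivatives
of `Γ` and `1/Γ` being complete Bell polynomials in those of `± ψ` (`recipTaylor_convolution`).

Convergence is only conditional for `q = 1`, so the interchange of the two summations is the
analytic core. For `x ≠ 1` (`tendsto_bilateral_of_ne_one`) the sum over `n` is summed by parts.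
The boundary terms form convolutions of the sequence `e` in `ℓ^4` with a sequence in `ℓ^(4/3)`,
which tend to zero, and the rest is absolutely convergent. For `x = 1`, hence `q ≥ 2`, the shift
by `k` changes the partial sums of the divergent series `∑ 1 / (n + a)` by blocks of `k` terms
that tend to zero with a bound `C k^(1/4)` (`tendsto_bilateral_sub`); the sums `∑ 1 / (n + a)` and
`∑ 1 / (n + b)` then occur with opposite coefficients, as `g_{q-1} = (-1)^q ∑_k e_k`.
-/

noncomputable section

namespace AperyLike

/-! ### Normalized central binomial coefficients -/

/-- The normalized central binomial coefficient `binom(2k, k) / 4^k`. -/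
def centralCoeff (k : ℕ) : ℝ := (k.centralBinom : ℝ) / 4 ^ k

lemma centralCoeff_zero : centralCoeff 0 = 1 := by simp [centralCoeff]

lemma centralCoeff_pos (k : ℕ) : 0 < centralCoeff k := by
  have := Nat.centralBinom_pos k
  unfold centralCoeff
  positivity

lemma centralCoeff_succ (k : ℕ) :
    ((k : ℝ) + 1) * centralCoeff (k + 1) = (k + 1 / 2) * centralCoeff k := by
  have h : ((k : ℝ) + 1) * (k + 1).centralBinom = 2 * (2 * k + 1) * k.centralBinom := by
    exact_mod_cast Nat.succ_mul_centralBinom_succ k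
  unfold centralCoeff
  rw [pow_succ, mul_div_assoc', h]
  field_simp
  ring

lemma centralCoeff_antitone : Antitone centralCoeff := by
  refine antitone_nat_of_succ_le fun k => ?_
  have h := centralCoeff_succ k
  have hp := centralCoeff_pos k
  have hk : (0 : ℝ) < k + 1 := by positivity
  nlinarith

lemma centralCoeff_sq_le (k : ℕ) : centralCoeff k ^ 2 ≤ 1 / (2 * k + 1) := by
  induction k with
  | zero => simp [centralCoeff_zero]
  | succ k ih =>
    have h : centralCoeff (k + 1) = (k + 1 / 2) / (k + 1) * centralCoeff k := by
      have := centralCoeff_succ k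
      field_simp
      linarith
    rw [h, mul_pow]
    calc ((k + 1 / 2 : ℝ) / (k + 1)) ^ 2 * centralCoeff k ^ 2
        ≤ ((k + 1 / 2 : ℝ) / (k + 1)) ^ 2 * (1 / (2 * k + 1)) := by gcongr
      _ ≤ 1 / (2 * ((k + 1 : ℕ) : ℝ) + 1) := by
        push_cast
        rw [div_pow, div_mul_div_comm, div_le_div_iff₀ (by positivity) (by positivity)]
        have : (0 : ℝ) ≤ k := by positivity
        nlinarith

lemma centralCoeff_isBigO :
    centralCoeff =O[atTop] fun k : ℕ => (k : ℝ) ^ (-(1 / 2) : ℝ) := by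
  refine Asymptotics.IsBigO.of_bound 1 ?_
  filter_upwards [eventually_ge_atTop 1] with k hk
  have hk' : (0 : ℝ) < k := by exact_mod_cast hk
  rw [Real.norm_of_nonneg (centralCoeff_pos k).le, Real.norm_of_nonneg (by positivity), one_mul,
    Real.rpow_neg hk'.le, ← Real.sqrt_eq_rpow, ← Real.sqrt_inv]
  refine Real.le_sqrt_of_sq_le ((centralCoeff_sq_le k).trans ?_)
  rw [← one_div]
  exact one_div_le_one_div_of_le hk' (by linarith)

lemma centralCoeff_tendsto : Tendsto centralCoeff atTop (𝓝 0) :=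
  centralCoeff_isBigO.trans_tendsto
    ((tendsto_rpow_neg_atTop (by norm_num)).comp tendsto_natCast_atTop_atTop)

/-- The binomial series of `(1 - t)^(-1/2)`. -/
lemma hasSum_centralCoeff_mul_pow {t : ℝ} (ht : |t| < 1) :
    HasSum (fun k => centralCoeff k * t ^ k) ((1 - t) ^ (-(1 / 2) : ℝ)) := by
  have hc : ∀ n : ℕ, Ring.choose ((1 / 2 : ℝ) + n - 1) n = centralCoeff n := by
    intro n
    have h1 : Ring.choose ((1 / 2 : ℝ) + n - 1) n = Ring.multichoose (1 / 2 : ℝ) n := by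
      rw [Ring.choose]
      congr 1
      ring
    rw [h1]
    have h2 := Ring.factorial_nsmul_multichoose_eq_ascPochhammer (1 / 2 : ℝ) n
    have h3 : (ascPochhammer ℝ n).eval (1 / 2) = n.factorial * centralCoeff n := by
      induction n with
      | zero => simp [centralCoeff_zero]
      | succ n ih =>
        have h4 := ih (by rw [Ring.choose]; congr 1; ring)
          (Ring.factorial_nsmul_multichoose_eq_ascPochhammer (1 / 2 : ℝ) n)
        rw [ascPochhammer_succ_eval, h4, Nat.factorial_succ]
        push_cast
        have := centralCoeff_succ n
        linear_combination (-(n.factorial : ℝ)) * this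
    rw [Polynomial.ascPochhammer_smeval_eq_eval, h3, nsmul_eq_mul] at h2
    exact mul_left_cancel₀ (by positivity) h2
  have h := (Real.one_div_one_sub_rpow_hasFPowerSeriesOnBall_zero (1 / 2)).hasSum (y := t)
    (by simpa [Metric.eball, enorm_eq_nnnorm, ← NNReal.coe_lt_coe] using ht)
  simp only [zero_add, FormalMultilinearSeries.ofScalars_apply_eq, hc, smul_eq_mul] at h
  rw [Real.rpow_neg (by linarith [abs_lt.1 ht]), ← one_div]
  exact h

/-! ### Growth of `1 / (k + c)` -/

lemma inv_natCast_add_isBigO (c : ℂ) :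
    (fun k : ℕ => ((k : ℂ) + c)⁻¹) =O[atTop] fun k : ℕ => (k : ℝ) ^ (-1 : ℝ) := by
  refine Asymptotics.IsBigO.of_bound 2 ?_
  filter_upwards [eventually_gt_atTop 0, eventually_ge_atTop ⌈2 * ‖c‖⌉₊] with k hk0 hk
  have hk' : 2 * ‖c‖ ≤ k := Nat.ceil_le.1 hk
  have hk0' : (0 : ℝ) < k := by exact_mod_cast hk0
  have h1 : (k : ℝ) / 2 ≤ ‖(k : ℂ) + c‖ := by
    have := norm_sub_le ((k : ℂ) + c) c
    simp only [add_sub_cancel_right, Complex.norm_natCast] at this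
    linarith
  rw [norm_inv, Real.rpow_neg_one, norm_inv, Real.norm_of_nonneg hk0'.le]
  calc ‖(k : ℂ) + c‖⁻¹ ≤ ((k : ℝ) / 2)⁻¹ := inv_anti₀ (by positivity) h1
    _ = 2 * (k : ℝ)⁻¹ := by rw [inv_div, div_eq_mul_inv]

lemma summable_norm_centralCoeff_div (z : ℂ) :
    Summable fun k : ℕ => ‖(centralCoeff k : ℂ) / ((k : ℂ) + z)‖ := by
  have h : (fun k : ℕ => ‖(centralCoeff k : ℂ) / ((k : ℂ) + z)‖) =O[atTop]
      fun k : ℕ => (k : ℝ) ^ (-(3 / 2) : ℝ) := by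
    have h1 := (Complex.isBigO_ofReal_left.2 centralCoeff_isBigO).mul (inv_natCast_add_isBigO z)
    refine Asymptotics.IsBigO.norm_left (h1.trans_eventuallyEq ?_)
    filter_upwards [eventually_gt_atTop 0] with k hk
    rw [← Real.rpow_add (by exact_mod_cast hk)]
    norm_num
  exact summable_of_isBigO_nat (Real.summable_nat_rpow.2 (by norm_num)) h

/-! ### The reciprocal central binomial coefficient as a partial fraction series -/

/-- Expanding `(1 - t)^(-1/2)` in Euler's integral for `B(z, 1/2)`. -/
lemma hasSum_betaIntegral_half {z : ℂ} (hz : 0 < z.re) :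
    HasSum (fun k : ℕ => (centralCoeff k : ℂ) / (k + z)) (Complex.betaIntegral z (1 / 2)) := by
  have hre : ∀ k : ℕ, -1 < ((z + k - 1 : ℂ)).re := fun k => by
    have : (0 : ℝ) ≤ k := k.cast_nonneg
    simp
    linarith
  have hint : ∀ k : ℕ, MeasureTheory.IntegrableOn
      (fun t : ℝ => (centralCoeff k : ℂ) * (t : ℂ) ^ (z + k - 1)) (Set.Ioc 0 1) := fun k => by
    have := (intervalIntegral.intervalIntegrable_cpow' (a := 0) (b := 1) (hre k)).1
    exact this.const_mul _
  have hval : ∀ k : ℕ, ∫ t in Set.Ioc (0 : ℝ) 1, (centralCoeff k : ℂ) * (t : ℂ) ^ (z + k - 1)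
      = (centralCoeff k : ℂ) / (k + z) := fun k => by
    have hne : z + k ≠ 0 := fun h => by
      have := congrArg Complex.re h
      have hk : (0 : ℝ) ≤ k := k.cast_nonneg
      simp at this
      linarith
    rw [MeasureTheory.integral_const_mul, ← intervalIntegral.integral_of_le zero_le_one,
      integral_cpow (Or.inl (hre k))]
    simp only [sub_add_cancel, Complex.ofReal_one, Complex.one_cpow, Complex.ofReal_zero,
      Complex.zero_cpow hne, sub_zero]
    rw [add_comm z, mul_one_div]
  have hnorm : ∀ k : ℕ,
      ∫ t in Set.Ioc (0 : ℝ) 1, ‖(centralCoeff k : ℂ) * (t : ℂ) ^ (z + k - 1)‖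
      = ‖(centralCoeff k : ℂ) / ((k : ℂ) + (z.re : ℂ))‖ := fun k => by
    have h1 : ∫ t in Set.Ioc (0 : ℝ) 1, ‖(centralCoeff k : ℂ) * (t : ℂ) ^ (z + k - 1)‖
        = ∫ t in Set.Ioc (0 : ℝ) 1, centralCoeff k * t ^ (z.re + k - 1) := by
      refine MeasureTheory.setIntegral_congr_fun measurableSet_Ioc fun t ht => ?_
      simp only [norm_mul, Complex.norm_real, Real.norm_of_nonneg (centralCoeff_pos k).le,
        Complex.norm_cpow_eq_rpow_re_of_pos ht.1]
      simp
    have hk : (0 : ℝ) ≤ k := k.cast_nonneg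
    rw [h1, MeasureTheory.integral_const_mul, ← intervalIntegral.integral_of_le zero_le_one,
      integral_rpow (Or.inl (by linarith))]
    have h2 : (k : ℂ) + (z.re : ℂ) = ((k + z.re : ℝ) : ℂ) := by push_cast; rfl
    rw [h2, norm_div, Complex.norm_real, Complex.norm_real,
      Real.norm_of_nonneg (centralCoeff_pos k).le, Real.norm_of_nonneg (by positivity),
      sub_add_cancel, Real.one_rpow, Real.zero_rpow (by positivity), sub_zero, add_comm z.re,
      mul_one_div]
  have key := MeasureTheory.hasSum_integral_of_summable_integral_norm hint
    (by simpa only [hnorm] using summable_norm_centralCoeff_div (z.re : ℂ))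
  simp only [hval] at key
  refine (congrArg (HasSum _) ?_).mpr key
  rw [Complex.betaIntegral, intervalIntegral.integral_of_le zero_le_one]
  refine MeasureTheory.setIntegral_congr_ae measurableSet_Ioc ?_
  filter_upwards [MeasureTheory.Measure.ae_ne MeasureTheory.volume (1 : ℝ)] with t ht1 ht
  have ht' : t < 1 := lt_of_le_of_ne ht.2 ht1
  have hs := hasSum_centralCoeff_mul_pow (t := t) (by rw [abs_of_pos ht.1]; exact ht')
  have hs' := (Complex.hasSum_ofReal.2 hs).mul_left ((t : ℂ) ^ (z - 1))
  have h0 : (t : ℂ) ≠ 0 := by exact_mod_cast ht.1.ne'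
  have h3 : ((1 : ℂ) - t) ^ ((1 : ℂ) / 2 - 1) = (((1 - t) ^ (-(1 / 2) : ℝ) : ℝ) : ℂ) := by
    rw [Complex.ofReal_cpow (by linarith)]
    push_cast
    norm_num
  rw [h3, ← hs'.tsum_eq]
  refine tsum_congr fun k => ?_
  rw [show z + k - 1 = (z - 1) + k by ring, Complex.cpow_add _ _ h0, Complex.cpow_natCast]
  push_cast
  ring

/-- The series `1 + ∑_{k ≥ 1} 4^{-k} binom(2k, k) z / (z + k)`. The term of index `0` of the partial
fraction series, `z / (z + 0)`, is written as `1` so that `z = 0` needs no exception. -/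
def recipSeries (z : ℂ) : ℂ := 1 + z * ∑' k : ℕ, (centralCoeff (k + 1) : ℂ) / ((k + 1 : ℕ) + z)

lemma summable_centralCoeff_succ_div (z : ℂ) :
    Summable fun k : ℕ => (centralCoeff (k + 1) : ℂ) / ((k + 1 : ℕ) + z) :=
  ((summable_nat_add_iff 1).2 (summable_norm_centralCoeff_div z)).of_norm

/-- The functional equation of `recipSeries`, by telescoping of `k 4^{-k} binom(2k,k) / (z + k)`. -/
lemma recipSeries_add_one {z : ℂ} (hz : ∀ n : ℕ, z + (n + 1) ≠ 0) :
    (z + 1 / 2) * recipSeries (z + 1) = (z + 1) * recipSeries z := by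
  have hs0 := (summable_centralCoeff_succ_div z).hasSum
  have hs1 := (summable_norm_centralCoeff_div (z + 1)).of_norm.hasSum
  have hsucc : ∀ k : ℕ, ((k : ℂ) + 1) * centralCoeff (k + 1) = (k + 1 / 2) * centralCoeff k :=
    fun k => by
      have := congrArg (fun r : ℝ => (r : ℂ)) (centralCoeff_succ k)
      push_cast at this
      exact this
  set A := ∑' k : ℕ, (centralCoeff (k + 1) : ℂ) / ((k + 1 : ℕ) + z) with hA
  -- the full series at `z + 1`, including the term of index `0`
  have hB : recipSeries (z + 1)
      = (z + 1) * ∑' k : ℕ, (centralCoeff k : ℂ) / ((k : ℂ) + (z + 1)) := by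
    rw [recipSeries, (summable_norm_centralCoeff_div (z + 1)).of_norm.tsum_eq_zero_add]
    have := hz 0
    simp only [Nat.cast_zero, zero_add] at this
    simp only [centralCoeff_zero, Nat.cast_zero, Complex.ofReal_one, zero_add]
    field_simp
  have hC : recipSeries z = 1 + z * A := rfl
  rw [hB, hC]
  have key : (z + 1 / 2) * ∑' k : ℕ, (centralCoeff k : ℂ) / ((k : ℂ) + (z + 1)) = 1 + z * A := by
    have ht : HasSum (fun k : ℕ => (z + 1 / 2) * ((centralCoeff k : ℂ) / ((k : ℂ) + (z + 1)))
        - z * ((centralCoeff (k + 1) : ℂ) / ((k + 1 : ℕ) + z)))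
        ((z + 1 / 2) * (∑' k : ℕ, (centralCoeff k : ℂ) / ((k : ℂ) + (z + 1))) - z * A) :=
      (hs1.mul_left _).sub (hs0.mul_left _)
    have hterm : ∀ k : ℕ, (z + 1 / 2) * ((centralCoeff k : ℂ) / ((k : ℂ) + (z + 1)))
        - z * ((centralCoeff (k + 1) : ℂ) / ((k + 1 : ℕ) + z))
        = (centralCoeff k : ℂ) - centralCoeff (k + 1) := fun k => by
      have h1 : (k : ℂ) + (z + 1) ≠ 0 := by
        have := hz k
        rwa [show z + ((k : ℂ) + 1) = k + (z + 1) by ring] at this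
      have h2 : ((k + 1 : ℕ) : ℂ) + z = k + (z + 1) := by push_cast; ring
      rw [h2]
      field_simp
      linear_combination 2 * hsucc k
    simp only [hterm] at ht
    have hlim : Tendsto (fun N : ℕ => ∑ k ∈ Finset.range N,
        ((centralCoeff k : ℂ) - centralCoeff (k + 1))) atTop (𝓝 (1 - 0)) := by
      simp only [Finset.sum_range_sub', centralCoeff_zero, Complex.ofReal_one]
      refine tendsto_const_nhds.sub ?_
      have := (Complex.continuous_ofReal.tendsto 0).comp centralCoeff_tendsto
      simpa [Function.comp_def] using this
    have := tendsto_nhds_unique ht.tendsto_sum_nat hlim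
    linear_combination this
  linear_combination (z + 1) * key

/-- The value of `recipSeries` in the half plane `Re z > -n`, by induction on `n`. -/
lemma recipSeries_eq_Gamma_aux (n : ℕ) : ∀ z : ℂ, (∀ m : ℕ, z + (m + 1) ≠ 0) → 0 < z.re + n →
    recipSeries z = (√Real.pi : ℂ) * Complex.Gamma (z + 1) * (Complex.Gamma (z + 1 / 2))⁻¹ := by
  induction n with
  | zero =>
    intro z _ hre
    simp only [Nat.cast_zero, add_zero] at hre
    have h0 : z ≠ 0 := fun h => by simp [h] at hre
    have hS := hasSum_betaIntegral_half hre
    have h1 : recipSeries z = z * Complex.betaIntegral z (1 / 2) := by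
      rw [← hS.tsum_eq, hS.summable.tsum_eq_zero_add, recipSeries]
      simp only [centralCoeff_zero, Nat.cast_zero, Complex.ofReal_one, zero_add]
      field_simp
    have h2 := Complex.Gamma_mul_Gamma_eq_betaIntegral (s := z) (t := 1 / 2) hre (by norm_num)
    have h3 : Complex.Gamma (z + 1 / 2) ≠ 0 :=
      Complex.Gamma_ne_zero_of_re_pos (by simp; linarith)
    rw [Complex.Gamma_one_half_eq] at h2
    have h4 : (Real.pi : ℂ) ^ (1 / 2 : ℂ) = (√Real.pi : ℂ) := by
      rw [Real.sqrt_eq_rpow, Complex.ofReal_cpow Real.pi_pos.le]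
      norm_num
    rw [h1, Complex.Gamma_add_one z h0, eq_mul_inv_iff_mul_eq₀ h3]
    rw [h4] at h2
    linear_combination (-z) * h2
  | succ n ih =>
    intro z hz hre
    have hz' : ∀ m : ℕ, z + 1 + (m + 1) ≠ 0 := fun m => by
      have := hz (m + 1)
      push_cast at this
      rwa [add_assoc, add_comm (1 : ℂ)]
    have h1 := ih (z + 1) hz' (by push_cast at hre; simp; linarith)
    have hz1 : z + 1 ≠ 0 := by simpa using hz 0
    have h2 := recipSeries_add_one hz
    rw [h1, Complex.Gamma_add_one (z + 1) hz1] at h2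
    have h3 : (z + 1 / 2) * (Complex.Gamma (z + 1 + 1 / 2))⁻¹ = (Complex.Gamma (z + 1 / 2))⁻¹ := by
      rw [show z + 1 + 1 / 2 = z + 1 / 2 + 1 by ring]
      exact (Complex.one_div_Gamma_eq_self_mul_one_div_Gamma_add_one (z + 1 / 2)).symm
    apply mul_left_cancel₀ hz1
    rw [← h2, ← h3]
    ring

lemma recipSeries_eq_Gamma {z : ℂ} (hz : ∀ m : ℕ, z + (m + 1) ≠ 0) :
    recipSeries z = (√Real.pi : ℂ) * Complex.Gamma (z + 1) * (Complex.Gamma (z + 1 / 2))⁻¹ := by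
  obtain ⟨n, hn⟩ := exists_nat_gt (-z.re)
  exact recipSeries_eq_Gamma_aux n z hz (by linarith)

/-- Off the negative integers, `recipSeries z = 4^z / binom(2z, z)`. -/
lemma recipSeries_eq {z : ℂ} (hz : ∀ m : ℕ, z + (m + 1) ≠ 0) :
    recipSeries z
      = (4 : ℂ) ^ z * Complex.Gamma (z + 1) ^ 2 * (Complex.Gamma (2 * z + 1))⁻¹ := by
  have hG : Complex.Gamma (z + 1) ≠ 0 := Complex.Gamma_ne_zero fun m h => hz m (by
    rw [show z + ((m : ℂ) + 1) = z + 1 + m by ring, h]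
    ring)
  have hpi : (√Real.pi : ℂ) ≠ 0 := by
    have := Real.pi_pos
    exact_mod_cast (Real.sqrt_pos.2 this).ne'
  have hL := Complex.Gamma_mul_Gamma_add_half (z + 1 / 2)
  rw [show z + 1 / 2 + 1 / 2 = z + 1 by ring, show 2 * (z + 1 / 2) = 2 * z + 1 by ring,
    show 1 - (2 * z + 1) = -(2 * z) by ring, Complex.cpow_neg] at hL
  have h4 : (4 : ℂ) ^ z = 2 ^ (2 * z) := by
    have := Complex.natCast_mul_natCast_cpow 2 2 z
    rw [two_mul, Complex.cpow_add _ _ two_ne_zero]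
    norm_num at this
    exact this
  have h2 : (2 : ℂ) ^ (2 * z) ≠ 0 := by simp [Complex.cpow_eq_zero_iff]
  rw [recipSeries_eq_Gamma hz, h4]
  have hinv : (Complex.Gamma (z + 1 / 2))⁻¹
      = (2 : ℂ) ^ (2 * z) * Complex.Gamma (z + 1) * (Complex.Gamma (2 * z + 1))⁻¹
        * (√Real.pi : ℂ)⁻¹ := by
    have := congrArg (·⁻¹) hL
    simp only [mul_inv, inv_inv] at this
    rw [← mul_left_inj' (inv_ne_zero hG), this]
    field_simp
  rw [hinv]
  field_simp

/-! ### Taylor expansion of the partial fraction series -/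

/-- The coefficient `k binom(2k, k) / (4^k (k + d)^s)`. It vanishes at `k = 0`, also for `d = 0`, so
that sums over `k ≥ 1` may be taken over all `k`. -/
def residueCoeff (s : ℕ) (d : ℂ) (k : ℕ) : ℂ := (k : ℂ) * centralCoeff k / ((k : ℂ) + d) ^ s

lemma residueCoeff_zero (s : ℕ) (d : ℂ) : residueCoeff s d 0 = 0 := by simp [residueCoeff]

lemma residueCoeff_isBigO (s : ℕ) (d : ℂ) :
    residueCoeff s d =O[atTop] fun k : ℕ => (k : ℝ) ^ (1 / 2 - s : ℝ) := by
  have h1 : (fun k : ℕ => (k : ℂ)) =O[atTop] fun k : ℕ => (k : ℝ) :=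
    Asymptotics.IsBigO.of_norm_left (by simpa using Asymptotics.isBigO_refl _ _)
  have h2 := (h1.mul (Complex.isBigO_ofReal_left.2 centralCoeff_isBigO)).mul
    ((inv_natCast_add_isBigO d).pow s)
  refine (h2.congr_left fun k => ?_).trans_eventuallyEq ?_
  · simp [residueCoeff, div_eq_mul_inv]
  · filter_upwards [eventually_gt_atTop 0] with k hk
    have hk' : (0 : ℝ) < k := by exact_mod_cast hk
    rw [← Real.rpow_natCast, ← Real.rpow_mul hk'.le, ← Real.rpow_one_add' hk'.le (by norm_num),
      ← Real.rpow_add hk']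
    congr 1
    ring

lemma summable_norm_residueCoeff {s : ℕ} (hs : 2 ≤ s) (d : ℂ) :
    Summable fun k => ‖residueCoeff s d k‖ := by
  have hs' : (2 : ℝ) ≤ s := by exact_mod_cast hs
  exact summable_of_isBigO_nat (Real.summable_nat_rpow.2 (by linarith))
    (residueCoeff_isBigO s d).norm_left

lemma summable_residueCoeff_mul_inv {s : ℕ} (hs : 1 ≤ s) (d w : ℂ) :
    Summable fun k : ℕ => residueCoeff s d k * ((k : ℂ) + w)⁻¹ := by
  have hs' : (1 : ℝ) ≤ s := by exact_mod_cast hs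
  have h := (residueCoeff_isBigO s d).mul (inv_natCast_add_isBigO w)
  have h2 : (fun k : ℕ => residueCoeff s d k * ((k : ℂ) + w)⁻¹)
      =O[atTop] fun k : ℕ => (k : ℝ) ^ (1 / 2 - s + -1 : ℝ) := by
    refine h.trans_eventuallyEq ?_
    filter_upwards [eventually_gt_atTop 0] with k hk
    rw [← Real.rpow_add (by exact_mod_cast hk)]
  exact summable_of_isBigO_nat (Real.summable_nat_rpow.2 (by linarith)) h2

lemma residueCoeff_mul_inv (s : ℕ) (d : ℂ) (k : ℕ) :
    residueCoeff s d k * ((k : ℂ) + d)⁻¹ = residueCoeff (s + 1) d k := by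
  simp only [residueCoeff, pow_succ, div_eq_mul_inv, mul_inv]
  ring

/-- The factor of `-(-1)^s u^s` in the remainder of order `s` of the Taylor expansion of
`recipSeries` at `d`. -/
def taylorRemainder (s : ℕ) (d u : ℂ) : ℂ :=
  ∑' k : ℕ, residueCoeff s d k * ((k : ℂ) + (d + u))⁻¹

/-- The Taylor coefficients of `recipSeries` at `d`, the one of index `j ≥ 1` obtained from the
series differentiated termwise. -/
def recipTaylor (d : ℂ) (j : ℕ) : ℂ :=
  if j = 0 then recipSeries d else (-1) ^ (j - 1) * ∑' k : ℕ, residueCoeff (j + 1) d k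

lemma taylorRemainder_eq {d u : ℂ} (hd : ∀ m : ℕ, d + (m + 1) ≠ 0)
    (hu : ∀ m : ℕ, d + u + (m + 1) ≠ 0) {s : ℕ} (hs : 1 ≤ s) :
    taylorRemainder s d u
      = ∑' k : ℕ, residueCoeff (s + 1) d k - u * taylorRemainder (s + 1) d u := by
  rw [taylorRemainder, taylorRemainder, ← tsum_mul_left,
    ← (summable_norm_residueCoeff (by omega) d).of_norm.tsum_sub
      ((summable_residueCoeff_mul_inv (by omega) d (d + u)).mul_left u)]
  refine tsum_congr fun k => ?_
  rcases k with _ | k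
  · simp [residueCoeff_zero]
  have h1 : ((k + 1 : ℕ) : ℂ) + d ≠ 0 := by
    have := hd k
    push_cast
    rwa [add_comm]
  have h2 : ((k + 1 : ℕ) : ℂ) + (d + u) ≠ 0 := by
    have := hu k
    push_cast
    rwa [add_comm]
  simp only [residueCoeff, pow_succ]
  field_simp
  ring

lemma recipSeries_sub {d u : ℂ} (hd : ∀ m : ℕ, d + (m + 1) ≠ 0)
    (hu : ∀ m : ℕ, d + u + (m + 1) ≠ 0) :
    recipSeries (d + u) = recipSeries d + u * taylorRemainder 1 d u := by
  have hR : taylorRemainder 1 d u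
      = ∑' k : ℕ, residueCoeff 1 d (k + 1) * (((k + 1 : ℕ) : ℂ) + (d + u))⁻¹ := by
    rw [taylorRemainder, (summable_residueCoeff_mul_inv le_rfl d (d + u)).tsum_eq_zero_add]
    simp [residueCoeff_zero]
  have hs : Summable fun k : ℕ => residueCoeff 1 d (k + 1) * (((k + 1 : ℕ) : ℂ) + (d + u))⁻¹ :=
    (summable_nat_add_iff 1).2 (summable_residueCoeff_mul_inv le_rfl d (d + u))
  have h0 := summable_centralCoeff_succ_div d
  have h1 := summable_centralCoeff_succ_div (d + u)
  have key : (d + u) * (∑' k : ℕ, (centralCoeff (k + 1) : ℂ) / ((k + 1 : ℕ) + (d + u)))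
      = d * (∑' k : ℕ, (centralCoeff (k + 1) : ℂ) / ((k + 1 : ℕ) + d))
        + u * taylorRemainder 1 d u := by
    rw [hR, ← tsum_mul_left, ← tsum_mul_left, ← tsum_mul_left,
      ← (h0.mul_left d).tsum_add (hs.mul_left u)]
    refine tsum_congr fun k => ?_
    have h1 : ((k + 1 : ℕ) : ℂ) + d ≠ 0 := by
      have := hd k
      push_cast
      rwa [add_comm]
    have h2 : ((k + 1 : ℕ) : ℂ) + (d + u) ≠ 0 := by
      have := hu k
      push_cast
      rwa [add_comm]
    simp only [residueCoeff, pow_one]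
    field_simp
    ring
  rw [recipSeries, recipSeries, key]
  ring

lemma recipSeries_taylor {d u : ℂ} (hd : ∀ m : ℕ, d + (m + 1) ≠ 0)
    (hu : ∀ m : ℕ, d + u + (m + 1) ≠ 0) {q : ℕ} (hq : 1 ≤ q) :
    recipSeries (d + u) = ∑ j ∈ Finset.range q, recipTaylor d j * u ^ j
      - (-1) ^ q * u ^ q * taylorRemainder q d u := by
  induction q, hq using Nat.le_induction with
  | base =>
    rw [recipSeries_sub hd hu]
    simp [recipTaylor]
  | succ q hq ih =>
    rw [ih, taylorRemainder_eq hd hu hq, Finset.sum_range_succ]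
    have : recipTaylor d q = -(-1) ^ q * ∑' k : ℕ, residueCoeff (q + 1) d k := by
      obtain ⟨p, rfl⟩ : ∃ p, q = p + 1 := ⟨q - 1, by omega⟩
      simp [recipTaylor, pow_succ]
    rw [this]
    ring

/-- A point off the negative integers has positive distance from them. -/
lemma exists_inv_norm_le (d : ℂ) : ∃ C : ℝ, 0 < C ∧ ∀ k : ℕ, ‖((k : ℂ) + d)⁻¹‖ ≤ C := by
  have h : Tendsto (fun k : ℕ => ‖((k : ℂ) + d)⁻¹‖) atTop (𝓝 0) :=
    ((inv_natCast_add_isBigO d).trans_tendsto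
      ((tendsto_rpow_neg_atTop one_pos).comp tendsto_natCast_atTop_atTop)).norm.trans (by simp)
  obtain ⟨C, hC⟩ := h.bddAbove_range
  exact ⟨max C 1, by positivity, fun k => (hC ⟨k, rfl⟩).trans (le_max_left _ _)⟩

lemma exists_norm_add_ge {d : ℂ} (hd : ∀ m : ℕ, d + (m + 1) ≠ 0) : ∃ δ : ℝ, 0 < δ ∧
    ∀ u : ℂ, ‖u‖ < δ → ∀ k : ℕ, ‖((k + 1 : ℕ) : ℂ) + d‖ ≤ 2 * ‖((k + 1 : ℕ) : ℂ) + (d + u)‖ := by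
  obtain ⟨C, hC0, hC⟩ := exists_inv_norm_le d
  refine ⟨(2 * C)⁻¹, by positivity, fun u hu k => ?_⟩
  have h1 : ((k + 1 : ℕ) : ℂ) + d ≠ 0 := by
    have := hd k
    push_cast
    rwa [add_comm]
  have h2 := hC (k + 1)
  rw [norm_inv, inv_le_comm₀ (norm_pos_iff.2 h1) hC0] at h2
  have h3 := norm_sub_le (((k + 1 : ℕ) : ℂ) + (d + u)) u
  rw [show ((k + 1 : ℕ) : ℂ) + (d + u) - u = ((k + 1 : ℕ) : ℂ) + d by ring] at h3
  rw [mul_inv] at hu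
  linarith

lemma eventually_ne_neg {d : ℂ} (hd : ∀ m : ℕ, d + (m + 1) ≠ 0) :
    ∀ᶠ u : ℂ in 𝓝 0, ∀ m : ℕ, d + u + (m + 1) ≠ 0 := by
  obtain ⟨δ, hδ, h⟩ := exists_norm_add_ge hd
  filter_upwards [Metric.ball_mem_nhds (0 : ℂ) hδ] with u hu m hm
  have h1 := h u (by simpa using hu) m
  rw [show ((m + 1 : ℕ) : ℂ) + (d + u) = 0 by rw [← hm]; push_cast; ring, norm_zero, mul_zero] at h1
  exact hd m (by rw [← norm_le_zero_iff, add_comm]; exact_mod_cast h1)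

lemma taylorRemainder_bounded {d : ℂ} (hd : ∀ m : ℕ, d + (m + 1) ≠ 0) {q : ℕ} (hq : 1 ≤ q) :
    (fun u => taylorRemainder q d u) =O[𝓝 0] fun _ => (1 : ℂ) := by
  obtain ⟨δ, hδ, h⟩ := exists_norm_add_ge hd
  have hs := summable_norm_residueCoeff (s := q + 1) (by omega) d
  refine Asymptotics.IsBigO.of_bound (∑' k, 2 * ‖residueCoeff (q + 1) d k‖) ?_
  filter_upwards [Metric.ball_mem_nhds (0 : ℂ) hδ, eventually_ne_neg hd] with u hu hne
  rw [norm_one, mul_one]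
  refine tsum_of_norm_bounded (hs.mul_left 2).hasSum fun k => ?_
  rcases k with _ | k
  · simp [residueCoeff_zero]
  have h1 : ((k + 1 : ℕ) : ℂ) + d ≠ 0 := by
    have := hd k
    push_cast
    rwa [add_comm]
  have h2 : ((k + 1 : ℕ) : ℂ) + (d + u) ≠ 0 := by
    have := hne k
    push_cast
    rwa [add_comm]
  have h3 := h u (by simpa using hu) k
  rw [← residueCoeff_mul_inv, norm_mul, norm_mul, norm_inv, norm_inv]
  have : ‖((k + 1 : ℕ) : ℂ) + (d + u)‖⁻¹ ≤ 2 * ‖((k + 1 : ℕ) : ℂ) + d‖⁻¹ := by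
    rw [← div_eq_mul_inv, le_div_iff₀ (norm_pos_iff.2 h1), ← div_eq_inv_mul,
      div_le_iff₀ (norm_pos_iff.2 h2)]
    exact h3
  calc _ ≤ ‖residueCoeff q d (k + 1)‖ * (2 * ‖((k + 1 : ℕ) : ℂ) + d‖⁻¹) := by gcongr
    _ = _ := by ring

/-- A polynomial of degree less than `q` that is `O(u^q)` at `0` vanishes. -/
lemma eq_zero_of_isBigO_pow (q : ℕ) : ∀ p : ℕ → ℂ,
    (fun u : ℂ => ∑ j ∈ Finset.range q, p j * u ^ j) =O[𝓝[≠] 0] (fun u : ℂ => u ^ q) →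
    ∀ j < q, p j = 0 := by
  induction q with
  | zero => intro p _ j hj; omega
  | succ q ih =>
    intro p hp
    have hlim : Tendsto (fun u : ℂ => ∑ j ∈ Finset.range (q + 1), p j * u ^ j) (𝓝[≠] 0)
        (𝓝 (p 0)) := by
      have : Continuous fun u : ℂ => ∑ j ∈ Finset.range (q + 1), p j * u ^ j := by fun_prop
      have h := (this.tendsto 0).mono_left (nhdsWithin_le_nhds (s := {0}ᶜ))
      simpa [Finset.sum_range_succ'] using h
    have hzero : Tendsto (fun u : ℂ => u ^ (q + 1)) (𝓝[≠] 0) (𝓝 0) := by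
      have : Continuous fun u : ℂ => u ^ (q + 1) := by fun_prop
      simpa using (this.tendsto 0).mono_left (nhdsWithin_le_nhds (s := {0}ᶜ))
    have h0 : p 0 = 0 := tendsto_nhds_unique hlim (hp.trans_tendsto hzero)
    have hp' : (fun u : ℂ => ∑ j ∈ Finset.range q, p (j + 1) * u ^ j)
        =O[𝓝[≠] 0] (fun u : ℂ => u ^ q) := by
      have h := hp.mul (Asymptotics.isBigO_refl (fun u : ℂ => u⁻¹) (𝓝[≠] 0))
      refine h.congr' ?_ ?_
      · filter_upwards [self_mem_nhdsWithin] with u hu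
        have hu : u ≠ 0 := hu
        rw [Finset.sum_range_succ', h0, zero_mul, add_zero, Finset.sum_mul]
        refine Finset.sum_congr rfl fun j _ => ?_
        field_simp
        ring
      · filter_upwards [self_mem_nhdsWithin] with u hu
        have hu : u ≠ 0 := hu
        field_simp
        ring
    intro j hj
    rcases j with _ | j
    · exact h0
    · exact ih (fun j => p (j + 1)) hp' j (by omega)

/-- Uniqueness of Taylor polynomials. -/
lemma iteratedDeriv_div_factorial_eq {f : ℂ → ℂ} {d : ℂ} (hf : AnalyticAt ℂ f d) {g : ℕ → ℂ} {q : ℕ}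
    (hg : (fun u : ℂ => f (d + u) - ∑ j ∈ Finset.range q, g j * u ^ j) =O[𝓝 0] fun u : ℂ => u ^ q)
    {j : ℕ} (hj : j < q) : iteratedDeriv j f d / j.factorial = g j := by
  have h1 := hf.hasFPowerSeriesAt.isBigO_sub_partialSum_pow q
  have h2 : (fun u : ℂ => f (d + u)
      - ∑ j ∈ Finset.range q, (iteratedDeriv j f d / j.factorial) * u ^ j)
      =O[𝓝 0] fun u : ℂ => u ^ q := by
    refine Asymptotics.IsBigO.of_norm_right ?_
    simpa only [norm_pow, FormalMultilinearSeries.partialSum,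
      FormalMultilinearSeries.ofScalars_apply_eq, smul_eq_mul] using h1
  have h3 := (hg.sub h2).mono (nhdsWithin_le_nhds (s := {0}ᶜ))
  have h4 := eq_zero_of_isBigO_pow q (fun j => iteratedDeriv j f d / j.factorial - g j)
    (h3.congr_left fun u => by simp only [sub_mul, Finset.sum_sub_distrib]; ring) j hj
  exact sub_eq_zero.1 h4

lemma recipTaylor_eq {f : ℂ → ℂ} {d : ℂ} (hd : ∀ m : ℕ, d + (m + 1) ≠ 0) (hf : AnalyticAt ℂ f d)
    (hfF : ∀ z : ℂ, (∀ m : ℕ, z + (m + 1) ≠ 0) → f z = recipSeries z) (j : ℕ) :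
    iteratedDeriv j f d / j.factorial = recipTaylor d j := by
  refine iteratedDeriv_div_factorial_eq (q := j + 1) hf ?_ j.lt_succ_self
  have h := (taylorRemainder_bounded hd (q := j + 1) (by omega)).mul
    (Asymptotics.isBigO_refl (fun u : ℂ => -(-1) ^ (j + 1) * u ^ (j + 1)) (𝓝 0))
  refine (h.congr' (g₂ := fun u : ℂ => -(-1) ^ (j + 1) * u ^ (j + 1)) ?_ ?_).trans ?_
  · filter_upwards [eventually_ne_neg hd] with u hu
    rw [hfF _ hu, recipSeries_taylor hd hu (q := j + 1) (by omega)]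
    ring
  · simp
  · exact Asymptotics.isBigO_const_mul_self _ _ _

/-! ### Taylor series, products and Bell polynomials -/

/-- The formal Taylor series of `f` at `z`. -/
def taylorSeries (f : ℂ → ℂ) (z : ℂ) : PowerSeries ℂ :=
  PowerSeries.mk fun n => iteratedDeriv n f z / n.factorial

lemma taylorSeries_mul {f g : ℂ → ℂ} {z : ℂ} (hf : AnalyticAt ℂ f z) (hg : AnalyticAt ℂ g z) :
    taylorSeries (f * g) z = taylorSeries f z * taylorSeries g z := by
  ext n
  rw [taylorSeries, PowerSeries.coeff_mk, iteratedDeriv_mul hf.contDiffAt hg.contDiffAt,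
    PowerSeries.coeff_mul, Finset.Nat.sum_antidiagonal_eq_sum_range_succ_mk, Finset.sum_div]
  refine Finset.sum_congr rfl fun i hi => ?_
  have hi' : i ≤ n := Nat.lt_succ_iff.1 (Finset.mem_range.1 hi)
  simp only [taylorSeries, PowerSeries.coeff_mk]
  have h : (n.choose i : ℂ) * i.factorial * (n - i).factorial = n.factorial := by
    exact_mod_cast Nat.choose_mul_factorial_mul_factorial hi'
  have h1 : (i.factorial : ℂ) ≠ 0 := by exact_mod_cast i.factorial_ne_zero
  have h2 : ((n - i).factorial : ℂ) ≠ 0 := by exact_mod_cast (n - i).factorial_ne_zero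
  have h3 : (n.factorial : ℂ) ≠ 0 := by exact_mod_cast n.factorial_ne_zero
  field_simp
  linear_combination (iteratedDeriv i f z * iteratedDeriv (n - i) g z) * h

lemma coeff_prod_eq_sum_antidiagonalTuple {m : ℕ} (P : Fin m → PowerSeries ℂ) (n : ℕ) :
    PowerSeries.coeff n (∏ i, P i)
      = ∑ k ∈ Finset.Nat.antidiagonalTuple m n, ∏ i, PowerSeries.coeff (k i) (P i) := by
  classical
  rw [PowerSeries.coeff_prod]
  refine Finset.sum_nbij' (fun l => ⇑l) (fun k => Finsupp.equivFunOnFinite.symm k) ?_ ?_ ?_ ?_ ?_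
  · intro l hl
    simpa [Finset.Nat.mem_antidiagonalTuple, Finset.mem_finsuppAntidiag] using hl
  · intro k hk
    simpa [Finset.Nat.mem_antidiagonalTuple, Finset.mem_finsuppAntidiag] using hk
  · intro l _
    ext
    simp
  · intro k _
    ext
    simp
  · intro l _
    rfl

lemma bellY_succ (u : ℕ → ℂ) (n : ℕ) : bellY u (n + 1)
    = ∑ j ∈ Finset.range (n + 1), (n.choose j : ℂ) * u (n + 1 - j) * bellY u j := by
  rw [bellY, Finset.sum_range]

lemma bellY_congr {u v : ℕ → ℂ} (h : ∀ k, 1 ≤ k → u k = v k) (n : ℕ) : bellY u n = bellY v n := by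
  induction n using Nat.strong_induction_on with
  | _ n ih =>
    rcases n with _ | n
    · simp [bellY]
    · rw [bellY_succ, bellY_succ]
      refine Finset.sum_congr rfl fun j hj => ?_
      have hj' := Finset.mem_range.1 hj
      rw [ih j hj', h _ (by omega)]

/-- The derivatives of a solution of `f' = f φ` are given by the complete Bell polynomials in the
derivatives of `φ`. -/
lemma iteratedDeriv_eq_bellY {f φ : ℂ → ℂ} {z : ℂ} (hf : AnalyticAt ℂ f z) (hφ : AnalyticAt ℂ φ z)
    (h : deriv f =ᶠ[𝓝 z] f * φ) (n : ℕ) :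
    iteratedDeriv n f z = f z * bellY (fun k => iteratedDeriv (k - 1) φ z) n := by
  induction n using Nat.strong_induction_on with
  | _ n ih =>
    rcases n with _ | n
    · simp [bellY]
    · rw [iteratedDeriv_succ', (h.iteratedDeriv n).eq_of_nhds,
        iteratedDeriv_mul hf.contDiffAt hφ.contDiffAt, bellY_succ, Finset.mul_sum]
      refine Finset.sum_congr rfl fun j hj => ?_
      have hj' := Finset.mem_range.1 hj
      rw [ih j hj', show n + 1 - j - 1 = n - j by omega]
      ring

lemma iteratedDeriv_digamma_add {z : ℂ} {k : ℕ} (hk : 1 ≤ k) :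
    iteratedDeriv (k - 1) (fun w => Complex.digamma (w + 1) + Real.eulerMascheroniConstant) z
      = polygammaSeq z k := by
  obtain ⟨k, rfl⟩ : ∃ j, k = j + 1 := ⟨k - 1, by omega⟩
  rw [polygammaSeq, Nat.add_sub_cancel]
  have h := congrFun (iteratedDeriv_comp_add_const k Complex.digamma 1) z
  rw [← h]
  rcases k with _ | k
  · simp
  · rw [iteratedDeriv_succ', iteratedDeriv_succ', deriv_add_const']
    simp

lemma analyticAt_Gamma {z : ℂ} (hz : ∀ m : ℕ, z ≠ -m) : AnalyticAt ℂ Complex.Gamma z := by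
  have h := (Complex.differentiable_one_div_Gamma.analyticAt z).inv
    (inv_ne_zero (Complex.Gamma_ne_zero hz))
  simpa only [Pi.inv_def, inv_inv] using h

lemma analyticAt_digamma {z : ℂ} (hz : ∀ m : ℕ, z ≠ -m) : AnalyticAt ℂ Complex.digamma z := by
  have hG := analyticAt_Gamma hz
  exact hG.deriv.div hG (Complex.Gamma_ne_zero hz)

lemma add_one_ne_neg {z : ℂ} (hz : ∀ m : ℕ, z + (m + 1) ≠ 0) (m : ℕ) : z + 1 ≠ -m := fun h =>
  hz m (by linear_combination h)

lemma eventually_add_one_ne_neg {d : ℂ} (hd : ∀ m : ℕ, d + (m + 1) ≠ 0) :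
    ∀ᶠ z : ℂ in 𝓝 d, ∀ m : ℕ, z + (m + 1) ≠ 0 := by
  have h : Tendsto (fun z : ℂ => z - d) (𝓝 d) (𝓝 0) := by
    have : Continuous fun z : ℂ => z - d := by fun_prop
    simpa using this.tendsto d
  filter_upwards [h.eventually (eventually_ne_neg hd)] with z hz m
  simpa using hz m

/-- `Γ(z + 1)`, with the factor `exp (γ (z - d))` that turns the logarithmic derivative `ψ` into
`ψ + γ`. -/
def gammaFactor (d z : ℂ) : ℂ :=
  Complex.exp (Real.eulerMascheroniConstant * (z - d)) * Complex.Gamma (z + 1)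

lemma analyticAt_digamma_add {d : ℂ} (hd : ∀ m : ℕ, d + (m + 1) ≠ 0) :
    AnalyticAt ℂ (fun w => Complex.digamma (w + 1) + Real.eulerMascheroniConstant) d :=
  ((analyticAt_digamma (add_one_ne_neg hd)).comp_of_eq (f := fun z : ℂ => z + 1)
    (by fun_prop) rfl).add analyticAt_const

lemma analyticAt_gammaFactor {d : ℂ} (hd : ∀ m : ℕ, d + (m + 1) ≠ 0) :
    AnalyticAt ℂ (gammaFactor d) d := by
  have h1 : AnalyticAt ℂ (fun z : ℂ => Complex.Gamma (z + 1)) d :=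
    (analyticAt_Gamma (add_one_ne_neg hd)).comp_of_eq (f := fun z : ℂ => z + 1) (by fun_prop) rfl
  have h2 : AnalyticAt ℂ (fun z : ℂ => Complex.exp (Real.eulerMascheroniConstant * (z - d))) d := by
    fun_prop
  exact h2.mul h1

lemma hasDerivAt_gammaFactor (d : ℂ) {z : ℂ} (hz : ∀ m : ℕ, z + (m + 1) ≠ 0) :
    HasDerivAt (gammaFactor d)
      (gammaFactor d z * (Complex.digamma (z + 1) + Real.eulerMascheroniConstant)) z := by
  have hne := add_one_ne_neg hz
  have h1 : HasDerivAt (fun z : ℂ => Complex.Gamma (z + 1)) (deriv Complex.Gamma (z + 1)) z :=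
    (Complex.differentiableAt_Gamma _ hne).hasDerivAt.comp_add_const z 1
  have h2 : HasDerivAt (fun z : ℂ => Complex.exp (Real.eulerMascheroniConstant * (z - d)))
      (Complex.exp (Real.eulerMascheroniConstant * (z - d))
        * (Real.eulerMascheroniConstant * 1)) z :=
    (((hasDerivAt_id z).sub_const d).const_mul _).cexp
  refine (h2.mul h1).congr_deriv ?_
  have hG := Complex.Gamma_ne_zero hne
  rw [gammaFactor, Complex.digamma_def, logDeriv_apply]
  field_simp
  ring

lemma iteratedDeriv_gammaFactor {d : ℂ} (hd : ∀ m : ℕ, d + (m + 1) ≠ 0) (n : ℕ) :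
    iteratedDeriv n (gammaFactor d) d = coeffC n d := by
  have h : deriv (gammaFactor d) =ᶠ[𝓝 d]
      gammaFactor d * fun w => Complex.digamma (w + 1) + Real.eulerMascheroniConstant := by
    filter_upwards [eventually_add_one_ne_neg hd] with z hz
    exact (hasDerivAt_gammaFactor d hz).deriv
  rw [iteratedDeriv_eq_bellY (analyticAt_gammaFactor hd) (analyticAt_digamma_add hd) h, coeffC,
    bellY_congr fun k hk => iteratedDeriv_digamma_add hk]
  simp [gammaFactor]

lemma iteratedDeriv_inv_gammaFactor {d : ℂ} (hd : ∀ m : ℕ, d + (m + 1) ≠ 0) (n : ℕ) :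
    iteratedDeriv n (gammaFactor d)⁻¹ d = coeffD n d := by
  have hne : ∀ z : ℂ, (∀ m : ℕ, z + (m + 1) ≠ 0) → gammaFactor d z ≠ 0 := fun z hz =>
    mul_ne_zero (Complex.exp_ne_zero _) (Complex.Gamma_ne_zero (add_one_ne_neg hz))
  have h : deriv (gammaFactor d)⁻¹ =ᶠ[𝓝 d]
      (gammaFactor d)⁻¹ * fun w => -(Complex.digamma (w + 1) + Real.eulerMascheroniConstant) := by
    filter_upwards [eventually_add_one_ne_neg hd] with z hz
    rw [((hasDerivAt_gammaFactor d hz).inv (hne z hz)).deriv]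
    have := hne z hz
    simp only [Pi.mul_apply, Pi.inv_apply]
    field_simp
  rw [iteratedDeriv_eq_bellY ((analyticAt_gammaFactor hd).inv (hne d hd))
    (analyticAt_digamma_add hd).neg h, coeffD,
    bellY_congr (v := fun k => -polygammaSeq d k) fun k hk => by
      rw [← iteratedDeriv_digamma_add hk]
      exact iteratedDeriv_fun_neg _ _ _]
  simp [gammaFactor, div_eq_inv_mul]

lemma iteratedDeriv_comp_const_mul' (f : ℂ → ℂ) (c : ℂ) (n : ℕ) :
    iteratedDeriv n (fun z => f (c * z)) = fun z => c ^ n * iteratedDeriv n f (c * z) := by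
  induction n with
  | zero => simp
  | succ n ih =>
    rw [iteratedDeriv_succ, ih, iteratedDeriv_succ]
    funext z
    rw [deriv_const_mul_field, deriv_comp_mul_left, smul_eq_mul]
    ring

lemma iteratedDeriv_four_cpow (n : ℕ) :
    iteratedDeriv n (fun z : ℂ => (4 : ℂ) ^ z)
      = fun z => (2 * (Real.log 2 : ℂ)) ^ n * (4 : ℂ) ^ z := by
  have hlog : Complex.log 4 = 2 * (Real.log 2 : ℂ) := by
    rw [show (4 : ℂ) = ((2 ^ 2 : ℝ) : ℂ) by norm_num, ← Complex.ofReal_log (by norm_num),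
      Real.log_pow]
    push_cast
    ring
  induction n with
  | zero => simp
  | succ n ih =>
    rw [iteratedDeriv_succ, ih]
    funext z
    have h : HasDerivAt (fun z : ℂ => (4 : ℂ) ^ z) ((4 : ℂ) ^ z * Complex.log 4 * 1) z :=
      (hasDerivAt_id z).const_cpow (Or.inl (by norm_num))
    rw [deriv_const_mul_field, h.deriv, hlog]
    ring

/-- The Taylor coefficients of `4^z / binom(2z, z)`, by way of its factors. The exponential factors
of `gammaFactor` cancel. -/
lemma recipTaylor_convolution {d : ℂ} (hd : ∀ m : ℕ, d + (m + 1) ≠ 0)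
    (h2d : ∀ m : ℕ, 2 * d + (m + 1) ≠ 0) (L : ℕ → ℂ) (n : ℕ) :
    ∑ j ∈ Finset.range (n + 1), recipTaylor d j * L (n - j)
      = (4 : ℂ) ^ d * ∑ k ∈ Finset.Nat.antidiagonalTuple 5 n,
          coeffC (k 0) d * coeffC (k 1) d * coeffD (k 2) (2 * d) * 2 ^ (k 2 + k 3)
            / (((k 0).factorial : ℂ) * ((k 1).factorial : ℂ) * ((k 2).factorial : ℂ)
                * ((k 3).factorial : ℂ))
            * (Real.log 2 : ℂ) ^ (k 3) * L (k 4) := by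
  set D : ℂ → ℂ := fun z => (gammaFactor (2 * d))⁻¹ (2 * z) with hD
  set P : ℂ → ℂ := fun z => (4 : ℂ) ^ z with hP
  have hC := analyticAt_gammaFactor hd
  have hDa : AnalyticAt ℂ D d := by
    have h1 := (analyticAt_gammaFactor h2d).inv (mul_ne_zero (Complex.exp_ne_zero _)
      (Complex.Gamma_ne_zero (add_one_ne_neg h2d)))
    exact h1.comp_of_eq (f := fun z : ℂ => 2 * z) (by fun_prop) rfl
  have hPa : AnalyticAt ℂ P d := by
    have : Differentiable ℂ P := fun z =>
      ((hasDerivAt_id z).const_cpow (Or.inl (by norm_num))).differentiableAt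
    exact this.analyticAt d
  have hprod : AnalyticAt ℂ (gammaFactor d * gammaFactor d * D * P) d :=
    ((hC.mul hC).mul hDa).mul hPa
  have hval : ∀ z : ℂ, (∀ m : ℕ, z + (m + 1) ≠ 0) →
      (gammaFactor d * gammaFactor d * D * P) z = recipSeries z := fun z hz => by
    rw [recipSeries_eq hz]
    simp only [Pi.mul_apply, Pi.inv_apply, hD, hP, gammaFactor, mul_inv, ← Complex.exp_neg]
    have : Complex.exp (Real.eulerMascheroniConstant * (z - d))
        * Complex.exp (Real.eulerMascheroniConstant * (z - d))
        * Complex.exp (-(Real.eulerMascheroniConstant * (2 * z - 2 * d))) = 1 := by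
      rw [← Complex.exp_add, ← Complex.exp_add, ← Complex.exp_zero]
      congr 1
      ring
    linear_combination (Complex.Gamma (z + 1) ^ 2 * (Complex.Gamma (2 * z + 1))⁻¹ * 4 ^ z) * this
  have hT : taylorSeries (gammaFactor d * gammaFactor d * D * P) d
      = taylorSeries (gammaFactor d) d * taylorSeries (gammaFactor d) d * taylorSeries D d
        * taylorSeries P d := by
    rw [taylorSeries_mul ((hC.mul hC).mul hDa) hPa, taylorSeries_mul (hC.mul hC) hDa,
      taylorSeries_mul hC hC]
  have hcoeff := coeff_prod_eq_sum_antidiagonalTuple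
    ![taylorSeries (gammaFactor d) d, taylorSeries (gammaFactor d) d, taylorSeries D d,
      taylorSeries P d, PowerSeries.mk L] n
  have hleft : (∏ i, ![taylorSeries (gammaFactor d) d, taylorSeries (gammaFactor d) d,
      taylorSeries D d, taylorSeries P d, PowerSeries.mk L] i)
      = taylorSeries (gammaFactor d * gammaFactor d * D * P) d * PowerSeries.mk L := by
    rw [hT]
    simp [Fin.prod_univ_succ, mul_assoc]
  rw [hleft, PowerSeries.coeff_mul, Finset.Nat.sum_antidiagonal_eq_sum_range_succ_mk] at hcoeff
  have hterm : ∀ j, PowerSeries.coeff j (taylorSeries (gammaFactor d * gammaFactor d * D * P) d)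
      = recipTaylor d j := fun j => by
    rw [taylorSeries, PowerSeries.coeff_mk, recipTaylor_eq hd hprod hval]
  simp only [hterm, PowerSeries.coeff_mk] at hcoeff
  rw [hcoeff, Finset.mul_sum]
  refine Finset.sum_congr rfl fun k _ => ?_
  have hDn : ∀ n, iteratedDeriv n D d = 2 ^ n * coeffD n (2 * d) := fun n => by
    rw [hD, iteratedDeriv_comp_const_mul']
    dsimp only
    rw [iteratedDeriv_inv_gammaFactor h2d]
  simp only [Fin.prod_univ_five, Matrix.cons_val, taylorSeries, PowerSeries.coeff_mk,
    iteratedDeriv_gammaFactor hd, hDn, hP, iteratedDeriv_four_cpow]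
  rw [pow_add, mul_pow]
  field_simp

/-! ### Bilateral sums -/

lemma bilateralPartialSum_eq (f : ℤ → ℂ) (M N : ℕ) : bilateralPartialSum f (M, N)
    = ∑ i ∈ Finset.range (N + 1), f i + ∑ i ∈ Finset.range M, f (-(i + 1 : ℕ)) := by
  induction M with
  | zero =>
    induction N with
    | zero => simp [bilateralPartialSum]
    | succ N ih =>
      have h : Finset.Icc (-((0 : ℕ) : ℤ)) ((N + 1 : ℕ) : ℤ)
          = insert ((N + 1 : ℕ) : ℤ) (Finset.Icc (-((0 : ℕ) : ℤ)) (N : ℤ)) := by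
        ext j
        simp only [Finset.mem_Icc, Finset.mem_insert]
        omega
      simp only [bilateralPartialSum] at ih ⊢
      rw [h, Finset.sum_insert (by simp), ih, Finset.sum_range_succ _ (N + 1)]
      simp only [Finset.range_zero, Finset.sum_empty]
      ring
  | succ M ih =>
    have h : Finset.Icc (-((M + 1 : ℕ) : ℤ)) (N : ℤ)
        = insert (-((M + 1 : ℕ) : ℤ)) (Finset.Icc (-(M : ℤ)) (N : ℤ)) := by
      ext j
      simp only [Finset.mem_Icc, Finset.mem_insert]
      omega
    simp only [bilateralPartialSum] at ih ⊢
    rw [h, Finset.sum_insert (by simp), ih, Finset.sum_range_succ _ M]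
    ring

lemma bilateralPartialSum_telescope (f : ℤ → ℂ) (M N : ℕ) :
    bilateralPartialSum (fun n => f n - f (n + 1)) (M, N) = f (-M) - f (N + 1) := by
  rw [bilateralPartialSum_eq]
  have h1 := Finset.sum_range_sub' (fun i : ℕ => f i) (N + 1)
  have h2 := Finset.sum_range_sub (fun i : ℕ => f (-i)) M
  push_cast at h1 h2 ⊢
  rw [h1]
  have h3 : ∀ i : ℕ, -((i : ℤ) + 1) + 1 = -i := fun i => by ring
  simp only [h3]
  rw [h2]
  simp

lemma tendsto_neg_fst_cofinite :
    Tendsto (fun p : ℕ × ℕ => -(p.1 : ℤ)) atTop cofinite := by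
  rw [Int.cofinite_eq, ← prod_atTop_atTop_eq]
  exact (tendsto_neg_atTop_atBot.comp (tendsto_natCast_atTop_atTop.comp tendsto_fst)).mono_right
    le_sup_left

lemma tendsto_snd_add_one_cofinite :
    Tendsto (fun p : ℕ × ℕ => (p.2 : ℤ) + 1) atTop cofinite := by
  rw [Int.cofinite_eq, ← prod_atTop_atTop_eq]
  exact ((tendsto_atTop_add_const_right _ _ tendsto_natCast_atTop_atTop).comp
    tendsto_snd).mono_right le_sup_right

lemma tendsto_bilateralPartialSum {f : ℤ → ℂ} (hf : Summable f) :
    Tendsto (bilateralPartialSum f) atTop (𝓝 (∑' n, f n)) := by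
  refine hf.hasSum.comp (tendsto_atTop_finset_of_monotone (fun p p' h => ?_) fun n => ?_)
  · have h1 : p.1 ≤ p'.1 := h.1
    have h2 : p.2 ≤ p'.2 := h.2
    exact Finset.Icc_subset_Icc (by omega) (by omega)
  · exact ⟨(n.natAbs, n.natAbs), by simp only [Finset.mem_Icc]; omega⟩

lemma bilateralPartialSum_tsum {ι : Type*} {f : ℤ → ι → ℂ} (hf : ∀ n, Summable (f n)) (p : ℕ × ℕ) :
    bilateralPartialSum (fun n => ∑' k, f n k) p = ∑' k, bilateralPartialSum (fun n => f n k) p :=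
  (Summable.tsum_finsetSum fun n _ => hf n).symm

lemma summable_norm_inv_intCast_add (c : ℂ) {s : ℝ} (hs : 1 < s) :
    Summable fun m : ℤ => ‖((m : ℂ) + c)⁻¹‖ ^ s := by
  have h : ∀ c : ℂ, Summable fun k : ℕ => ‖((k : ℂ) + c)⁻¹‖ ^ s := fun c => by
    have h1 := (inv_natCast_add_isBigO c).norm_left.rpow (r := s) (by linarith)
      (Eventually.of_forall fun k => by positivity)
    refine summable_of_isBigO_nat ((Real.summable_nat_rpow (p := -s)).2 (by linarith))
      (h1.congr_right fun k => ?_)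
    rw [← Real.rpow_mul (by positivity), neg_one_mul]
  refine Summable.of_nat_of_neg (by simpa using h c) ((h (-c)).congr fun k => ?_)
  rw [norm_inv, norm_inv, ← norm_neg ((k : ℂ) + -c)]
  congr 3
  push_cast
  ring

/-- Over all integers, `1 / ((m + c)(m + c'))` is summable. -/
lemma summable_inv_mul_inv (c c' : ℂ) :
    Summable fun m : ℤ => ‖((m : ℂ) + c)⁻¹ * ((m : ℂ) + c')⁻¹‖ := by
  refine Summable.of_nonneg_of_le (fun _ => norm_nonneg _) (fun m => ?_)
    ((summable_norm_inv_intCast_add c one_lt_two).add (summable_norm_inv_intCast_add c' one_lt_two))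
  rw [norm_mul, Real.rpow_two, Real.rpow_two]
  nlinarith [sq_nonneg (‖((m : ℂ) + c)⁻¹‖ - ‖((m : ℂ) + c')⁻¹‖),
    sq_nonneg ‖((m : ℂ) + c)⁻¹‖, sq_nonneg ‖((m : ℂ) + c')⁻¹‖]

/-! ### Convolution of `ℓ^4` with `ℓ^(4/3)` -/

lemma holderConjugate_four : (4 : ℝ).HolderConjugate (4 / 3) := by
  rw [Real.holderConjugate_iff]
  norm_num

lemma summable_shift {u : ℤ → ℝ} (hu : Summable fun m => u m ^ (4 / 3 : ℝ)) (n : ℤ) :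
    Summable fun k : ℕ => u (n + k) ^ (4 / 3 : ℝ) :=
  hu.comp_injective (i := fun k : ℕ => n + k) fun _ _ h => by simpa using h

lemma summable_convolution {e : ℕ → ℝ} {u : ℤ → ℝ} (he0 : ∀ k, 0 ≤ e k) (hu0 : ∀ m, 0 ≤ u m)
    (he : Summable fun k => e k ^ (4 : ℝ)) (hu : Summable fun m => u m ^ (4 / 3 : ℝ)) (n : ℤ) :
    Summable fun k : ℕ => e k * u (n + k) :=
  Real.summable_mul_of_Lp_Lq_of_nonneg holderConjugate_four he0 (fun _ => hu0 _) he
    (summable_shift hu n)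

lemma tendsto_convolution {e : ℕ → ℝ} {u : ℤ → ℝ} (he0 : ∀ k, 0 ≤ e k) (hu0 : ∀ m, 0 ≤ u m)
    (he : Summable fun k => e k ^ (4 : ℝ)) (hu : Summable fun m => u m ^ (4 / 3 : ℝ)) :
    Tendsto (fun n : ℤ => ∑' k : ℕ, e k * u (n + k)) cofinite (𝓝 0) := by
  have hu_lim : Tendsto u cofinite (𝓝 0) := by
    have h := hu.tendsto_cofinite_zero.rpow_const (p := 3 / 4) (Or.inr (by norm_num))
    rw [Real.zero_rpow (by norm_num)] at h
    refine h.congr fun m => ?_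
    rw [← Real.rpow_mul (hu0 m)]
    norm_num
  set Q := (∑' m, u m ^ (4 / 3 : ℝ)) ^ (1 / (4 / 3) : ℝ) with hQ
  -- Hölder's inequality bounds the contribution of the indices outside `S` uniformly in `n`
  have hsplit : ∀ (S : Finset ℕ) (n : ℤ), ∑' k : ℕ, e k * u (n + k)
      ≤ ∑ k ∈ S, e k * u (n + k) + (∑' k : {k // k ∉ S}, e k ^ (4 : ℝ)) ^ (1 / 4 : ℝ) * Q := by
    intro S n
    rw [← (summable_convolution he0 hu0 he hu n).sum_add_tsum_subtype_compl S]
    gcongr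
    have hs := summable_shift hu n
    refine (Real.inner_le_Lp_mul_Lq_tsum_of_nonneg holderConjugate_four
      (f := fun k : {k // k ∉ S} => e k) (g := fun k : {k // k ∉ S} => u (n + (k : ℕ)))
      (fun k => he0 k) (fun k => hu0 _) (he.subtype _) (hs.subtype _)).trans ?_
    refine mul_le_mul_of_nonneg_left (Real.rpow_le_rpow
      (tsum_nonneg fun _ => Real.rpow_nonneg (hu0 _) _) ?_ (by norm_num))
      (Real.rpow_nonneg (tsum_nonneg fun k => Real.rpow_nonneg (he0 _) _) _)
    exact tsum_comp_le_tsum_of_inj hu (fun m => Real.rpow_nonneg (hu0 m) _)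
      (i := fun k : {k // k ∉ S} => n + ((k : ℕ) : ℤ)) fun a b h => Subtype.ext (by simpa using h)
  have htail : Tendsto (fun S : Finset ℕ => (∑' k : {k // k ∉ S}, e k ^ (4 : ℝ)) ^ (1 / 4 : ℝ) * Q)
      atTop (𝓝 0) := by
    have h := ((tendsto_tsum_compl_atTop_zero fun k => e k ^ (4 : ℝ)).rpow_const (p := 1 / 4)
      (Or.inr (by norm_num))).mul_const Q
    rwa [Real.zero_rpow (by norm_num), zero_mul] at h
  refine tendsto_order.2 ⟨fun ε hε => Eventually.of_forall fun n =>
    hε.trans_le (tsum_nonneg fun k => mul_nonneg (he0 k) (hu0 _)), fun ε hε => ?_⟩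
  obtain ⟨S, hS⟩ := (htail.eventually_lt_const (half_pos hε)).exists
  have hfin : Tendsto (fun n : ℤ => ∑ k ∈ S, e k * u (n + k)) cofinite (𝓝 0) := by
    have h : ∀ k ∈ S, Tendsto (fun n : ℤ => e k * u (n + k)) cofinite (𝓝 (e k * 0)) := fun k _ =>
      (hu_lim.comp (add_left_injective (k : ℤ)).tendsto_cofinite).const_mul _
    simpa using tendsto_finsetSum S h
  filter_upwards [hfin.eventually_lt_const (half_pos hε)] with n hn
  linarith [hsplit S n]

lemma summable_convolution_complex {e : ℕ → ℂ} {u : ℤ → ℂ} (he : Summable fun k => ‖e k‖ ^ (4 : ℝ))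
    (hu : Summable fun m => ‖u m‖ ^ (4 / 3 : ℝ)) (n : ℤ) : Summable fun k : ℕ => e k * u (n + k) :=
  Summable.of_norm ((summable_convolution (fun _ => norm_nonneg _) (fun _ => norm_nonneg _) he hu
    n).congr fun _ => (norm_mul _ _).symm)

/-- The convolution of a sequence in `ℓ^4` with one in `ℓ^(4/3)` tends to zero. -/
lemma tendsto_convolution_complex {e : ℕ → ℂ} {u : ℤ → ℂ} (he : Summable fun k => ‖e k‖ ^ (4 : ℝ))
    (hu : Summable fun m => ‖u m‖ ^ (4 / 3 : ℝ)) :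
    Tendsto (fun n : ℤ => ∑' k : ℕ, e k * u (n + k)) cofinite (𝓝 0) := by
  refine squeeze_zero_norm (fun n => ?_)
    (tendsto_convolution (fun _ => norm_nonneg _) (fun _ => norm_nonneg _) he hu)
  have h := summable_convolution (fun _ => norm_nonneg _) (fun _ => norm_nonneg _) he hu n
  simp only [← norm_mul] at h ⊢
  exact norm_tsum_le_tsum_norm h

/-! ### Summation by parts for a character other than the trivial one -/

/-- The terms `y^m / (m + c)`, `m ∈ ℤ`. -/
def charTerm (y c : ℂ) (m : ℤ) : ℂ := y ^ m * ((m : ℂ) + c)⁻¹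

/-- The boundary terms `y^m / ((1 - y)(m + c))` of the summation by parts of `∑ y^m / (m + c)`. -/
def boundaryTerm (y c : ℂ) (m : ℤ) : ℂ := y ^ m * (1 - y)⁻¹ * ((m : ℂ) + c)⁻¹

/-- The absolutely summable terms `y^(m+1) / ((1 - y)(m + c)(m + c + 1))` left by the summation by
parts of `∑ y^m / (m + c)`. -/
def partsTerm (y c : ℂ) (m : ℤ) : ℂ :=
  y ^ (m + 1) * (1 - y)⁻¹ * (((m : ℂ) + c)⁻¹ * ((m : ℂ) + (c + 1))⁻¹)

section

variable {y c : ℂ}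

lemma charTerm_eq (hy : ‖y‖ = 1) (hy1 : y ≠ 1) (hc : ∀ n : ℤ, c ≠ n) (m : ℤ) :
    charTerm y c m = (boundaryTerm y c m - boundaryTerm y c (m + 1)) - partsTerm y c m := by
  have hy0 : y ≠ 0 := fun h => by simp [h] at hy
  have h1 : (m : ℂ) + c ≠ 0 := fun h => hc (-m) (by push_cast; linear_combination h)
  have h2 : (m : ℂ) + (c + 1) ≠ 0 := fun h => hc (-m - 1) (by push_cast; linear_combination h)
  have h3 : (1 : ℂ) - y ≠ 0 := sub_ne_zero.2 hy1.symm
  simp only [charTerm, boundaryTerm, partsTerm, zpow_add_one₀ hy0]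
  have h4 : ((m + 1 : ℤ) : ℂ) + c = (m : ℂ) + (c + 1) := by push_cast; ring
  rw [h4]
  field_simp
  ring

lemma summable_boundaryTerm (hy : ‖y‖ = 1) :
    Summable fun m => ‖boundaryTerm y c m‖ ^ (4 / 3 : ℝ) := by
  refine ((summable_norm_inv_intCast_add c (s := 4 / 3) (by norm_num)).mul_left
    (‖(1 - y)⁻¹‖ ^ (4 / 3 : ℝ))).congr fun m => ?_
  rw [boundaryTerm, norm_mul, norm_mul, norm_zpow, hy, one_zpow, one_mul,
    Real.mul_rpow (norm_nonneg _) (norm_nonneg _)]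

lemma summable_norm_partsTerm (hy : ‖y‖ = 1) : Summable fun m => ‖partsTerm y c m‖ := by
  refine ((summable_inv_mul_inv c (c + 1)).mul_left ‖(1 - y)⁻¹‖).congr fun m => ?_
  simp only [partsTerm, norm_mul, norm_zpow, hy, one_zpow, one_mul]

lemma tendsto_boundaryTerm (hy : ‖y‖ = 1) : Tendsto (boundaryTerm y c) cofinite (𝓝 0) := by
  have h := (summable_boundaryTerm (c := c) hy).tendsto_cofinite_zero.rpow_const (p := 3 / 4)
    (Or.inr (by norm_num))
  rw [Real.zero_rpow (by norm_num)] at h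
  refine tendsto_zero_iff_norm_tendsto_zero.2 (h.congr fun m => ?_)
  rw [← Real.rpow_mul (norm_nonneg _)]
  norm_num

lemma tendsto_charTerm (hy : ‖y‖ = 1) (hy1 : y ≠ 1) (hc : ∀ n : ℤ, c ≠ n) :
    Tendsto (bilateralPartialSum (charTerm y c)) atTop (𝓝 (-∑' m, partsTerm y c m)) := by
  have h1 := (tendsto_boundaryTerm (c := c) hy).comp tendsto_neg_fst_cofinite
  have h2 := (tendsto_boundaryTerm (c := c) hy).comp tendsto_snd_add_one_cofinite
  have h3 := tendsto_bilateralPartialSum (summable_norm_partsTerm (c := c) hy).of_norm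
  have h := (h1.sub h2).sub h3
  rw [sub_zero, zero_sub] at h
  refine h.congr fun p => ?_
  have h4 := bilateralPartialSum_telescope (boundaryTerm y c) p.1 p.2
  simp only [Function.comp_apply, ← h4, bilateralPartialSum, ← Finset.sum_sub_distrib]
  exact Finset.sum_congr rfl fun m _ => (charTerm_eq hy hy1 hc m).symm

end

/-- A convolution of a convergent series with a summable bilateral one: grouping the terms by
the argument of `r` leaves differences of partial sums of the first series, and dominated
convergence applies. -/
lemma tendsto_bilateral_convolution {E : ℕ → ℂ} {S : ℂ} {r : ℤ → ℂ}
    (hE : Tendsto (fun K => ∑ k ∈ Finset.range K, E k) atTop (𝓝 S))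
    (hr : Summable fun m => ‖r m‖) :
    Tendsto (bilateralPartialSum fun n => ∑' k : ℕ, E k * r (n + k)) atTop
      (𝓝 (S * ∑' m, r m)) := by
  -- the partial sums of `E`, as a function on the integers
  set A : ℤ → ℂ := fun j => ∑ k ∈ Finset.range (j + 1).toNat, E k with hA
  obtain ⟨B, hB⟩ := (Metric.isBounded_range_of_tendsto _ hE).exists_norm_le
  have hAB : ∀ j, ‖A j‖ ≤ B := fun j => hB _ ⟨_, rfl⟩
  have hAE : ∀ k : ℕ, A k - A (k - 1) = E k := fun k => by
    simp only [hA]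
    rw [show ((k : ℤ) + 1).toNat = k + 1 by omega, show ((k : ℤ) - 1 + 1).toNat = k by omega,
      Finset.sum_range_succ]
    ring
  have hAneg : ∀ j : ℤ, j < 0 → A j = 0 := fun j hj => by
    simp only [hA]
    rw [show (j + 1).toNat = 0 by omega, Finset.sum_range_zero]
  have hAtop : Tendsto A atTop (𝓝 S) := by
    refine hE.comp (tendsto_atTop.2 fun b => ?_)
    filter_upwards [eventually_ge_atTop (b : ℤ)] with j hj
    omega
  have hAbot : Tendsto A atBot (𝓝 0) := by
    refine tendsto_const_nhds.congr' ?_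
    filter_upwards [eventually_lt_atBot (0 : ℤ)] with j hj
    exact (hAneg j hj).symm
  -- `E k = A k - A (k - 1)` and `A` vanishes on negative integers, so `k` may range over `ℤ`
  have hreindex : ∀ n : ℤ, ∑' k : ℕ, E k * r (n + k)
      = ∑' m : ℤ, (A (m - n) - A (m - (n + 1))) * r m := fun n => by
    have hinj : Function.Injective fun k : ℕ => n + (k : ℤ) := fun _ _ h => by simpa using h
    rw [← hinj.tsum_eq]
    · refine tsum_congr fun k => ?_
      simp only [← hAE k, show n + (k : ℤ) - n = k by ring,
        show n + (k : ℤ) - (n + 1) = k - 1 by ring]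
    · intro m hm
      by_contra hcon
      refine hm ?_
      have hneg : m - n < 0 := by
        by_contra hge
        exact hcon ⟨(m - n).toNat, by simp only; omega⟩
      simp only [hAneg _ hneg, hAneg _ (show m - (n + 1) < 0 by omega), sub_self, zero_mul]
  have hsum : ∀ n : ℤ, Summable fun m : ℤ => (A (m - n) - A (m - (n + 1))) * r m := fun n => by
    refine Summable.of_norm_bounded (hr.mul_left (B + B)) fun m => ?_
    rw [norm_mul]
    gcongr
    exact (norm_sub_le _ _).trans (add_le_add (hAB _) (hAB _))
  have hfinal : ∀ p : ℕ × ℕ, bilateralPartialSum (fun n => ∑' k : ℕ, E k * r (n + k)) p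
      = ∑' m : ℤ, (A (m + p.1) - A (m - (p.2 + 1))) * r m := fun p => by
    simp only [hreindex]
    rw [bilateralPartialSum_tsum hsum]
    refine tsum_congr fun m => ?_
    have h := bilateralPartialSum_telescope (fun n => A (m - n)) p.1 p.2
    simp only [bilateralPartialSum, sub_neg_eq_add] at h ⊢
    rw [← h, Finset.sum_mul]
  rw [← tsum_mul_left, tendsto_congr hfinal]
  refine tendsto_tsum_of_dominated_convergence (hr.mul_left (B + B)) (fun m => ?_)
    (Eventually.of_forall fun p m => ?_)
  · have h1 : Tendsto (fun p : ℕ × ℕ => A (m + p.1)) atTop (𝓝 S) := by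
      rw [← prod_atTop_atTop_eq]
      exact hAtop.comp ((tendsto_atTop_add_const_left _ m tendsto_natCast_atTop_atTop).comp
        tendsto_fst)
    have h2 : Tendsto (fun p : ℕ × ℕ => A (m - (p.2 + 1))) atTop (𝓝 0) := by
      rw [← prod_atTop_atTop_eq]
      have h : Tendsto (fun N : ℕ => m - ((N : ℤ) + 1)) atTop atBot := by
        simp only [sub_eq_add_neg]
        exact tendsto_atBot_add_const_left _ m (tendsto_neg_atTop_atBot.comp
          (tendsto_atTop_add_const_right _ 1 tendsto_natCast_atTop_atTop))
      exact hAbot.comp (h.comp tendsto_snd)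
    simpa using (h1.sub h2).mul_const (r m)
  · rw [norm_mul]
    gcongr
    exact (norm_sub_le _ _).trans (add_le_add (hAB _) (hAB _))

/-- Interchange of summation in `∑_n x^(-n) ∑_k e_k / (n + k + a)` for `x ≠ 1`. -/
lemma tendsto_bilateral_of_ne_one {x a : ℂ} (hx : ‖x‖ = 1) (hx1 : x ≠ 1) (ha : ∀ n : ℤ, a ≠ n)
    {e : ℕ → ℂ} {S L : ℂ} (he : Summable fun k => ‖e k‖ ^ (4 : ℝ))
    (hS : Tendsto (fun K => ∑ k ∈ Finset.range K, e k * x ^ k) atTop (𝓝 S))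
    (hL : Tendsto (bilateralPartialSum (charTerm x⁻¹ a)) atTop (𝓝 L)) :
    Tendsto (bilateralPartialSum fun n => x ^ (-n) * ∑' k : ℕ, e k * ((k : ℂ) + (n + a))⁻¹) atTop
      (𝓝 (L * S)) := by
  have hy : ‖x⁻¹‖ = 1 := by rw [norm_inv, hx, inv_one]
  have hy1 : x⁻¹ ≠ 1 := fun h => hx1 (inv_eq_one.1 h)
  have hx0 : x ≠ 0 := fun h => by simp [h] at hx
  have he' : Summable fun k => ‖e k * x ^ k‖ ^ (4 : ℝ) := by simpa [hx] using he
  have hLe : L = -∑' m, partsTerm x⁻¹ a m := tendsto_nhds_unique hL (tendsto_charTerm hy hy1 ha)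
  set y := x⁻¹ with hyx
  have hterm : ∀ n : ℤ, x ^ (-n) * ∑' k : ℕ, e k * ((k : ℂ) + (n + a))⁻¹
      = ∑' k : ℕ, (e k * x ^ k) * charTerm y a (n + k) := fun n => by
    rw [← tsum_mul_left]
    refine tsum_congr fun k => ?_
    have h1 : y ^ (n + (k : ℤ)) = x ^ (-n) * (x ^ k)⁻¹ := by
      rw [hyx, inv_zpow, ← zpow_neg, neg_add, zpow_add₀ hx0, zpow_neg x (k : ℤ), zpow_natCast]
    have h2 : ((n + (k : ℤ) : ℤ) : ℂ) + a = k + (n + a) := by push_cast; ring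
    rw [charTerm, h1, h2]
    have : x ^ k ≠ 0 := pow_ne_zero _ hx0
    field_simp
  have hsP := summable_convolution_complex he' (summable_boundaryTerm (c := a) hy)
  have hsR : ∀ n : ℤ, Summable fun k : ℕ => (e k * x ^ k) * partsTerm y a (n + k) := fun n => by
    obtain ⟨B, hB⟩ := (he'.tendsto_atTop_zero).bddAbove_range
    have hEB : ∀ k, ‖e k * x ^ k‖ ≤ B + 1 := fun k => by
      have h1 : ‖e k * x ^ k‖ ^ (4 : ℝ) ≤ B := hB ⟨k, rfl⟩
      by_contra hcon
      push Not at hcon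
      have hB0 : 0 ≤ B := le_trans (by positivity) h1
      have h2 : (B + 1) ^ (4 : ℝ) < ‖e k * x ^ k‖ ^ (4 : ℝ) :=
        Real.rpow_lt_rpow (by linarith) hcon (by norm_num)
      have h3 : B + 1 ≤ (B + 1) ^ (4 : ℝ) :=
        Real.self_le_rpow_of_one_le (by linarith) (by norm_num)
      linarith
    refine Summable.of_norm_bounded (((summable_norm_partsTerm (c := a) hy).comp_injective
      (i := fun k : ℕ => n + (k : ℤ)) fun _ _ h => by simpa using h).mul_left (B + 1)) fun k => ?_
    rw [norm_mul]
    exact mul_le_mul_of_nonneg_right (hEB k) (norm_nonneg _)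
  -- the boundary terms telescope in `n`
  have hchar : ∀ n : ℤ, ∑' k : ℕ, (e k * x ^ k) * charTerm y a (n + k)
      = (∑' k : ℕ, (e k * x ^ k) * boundaryTerm y a (n + k)
          - ∑' k : ℕ, (e k * x ^ k) * boundaryTerm y a (n + 1 + k))
        - ∑' k : ℕ, (e k * x ^ k) * partsTerm y a (n + k) := fun n => by
    rw [← (hsP n).tsum_sub (hsP (n + 1)), ← ((hsP n).sub (hsP (n + 1))).tsum_sub (hsR n)]
    refine tsum_congr fun k => ?_
    rw [charTerm_eq hy hy1 ha, show n + (k : ℤ) + 1 = n + 1 + k by ring]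
    ring
  have h0 := tendsto_convolution_complex he' (summable_boundaryTerm (c := a) hy)
  have h := ((h0.comp tendsto_neg_fst_cofinite).sub (h0.comp tendsto_snd_add_one_cofinite)).sub
    (tendsto_bilateral_convolution hS (summable_norm_partsTerm (c := a) hy))
  rw [sub_zero, zero_sub] at h
  have hlim : -(S * ∑' m, partsTerm y a m) = L * S := by rw [hLe]; ring
  rw [hlim] at h
  refine h.congr fun p => ?_
  have h4 := bilateralPartialSum_telescope
    (fun n => ∑' k : ℕ, (e k * x ^ k) * boundaryTerm y a (n + k)) p.1 p.2
  simp only [Function.comp_apply, ← h4, bilateralPartialSum, ← Finset.sum_sub_distrib]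
  exact Finset.sum_congr rfl fun n _ => by rw [hterm, hchar]

/-! ### The trivial character -/

/-- Hölder's inequality bounds a block of `k` consecutive terms `1 / |m + a|` by `C k^(1/4)`. -/
lemma exists_norm_block_le (a : ℂ) : ∃ C : ℝ, ∀ (n : ℤ) (k : ℕ),
    ‖∑ i ∈ Finset.range k, ((n + (i : ℤ) : ℤ) + a : ℂ)⁻¹‖ ≤ C * (k : ℝ) ^ (1 / 4 : ℝ) := by
  have hu := summable_norm_inv_intCast_add a (s := 4 / 3) (by norm_num)
  refine ⟨(∑' m : ℤ, ‖((m : ℂ) + a)⁻¹‖ ^ (4 / 3 : ℝ)) ^ (1 / (4 / 3) : ℝ), fun n k => ?_⟩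
  have h1 := Real.inner_le_Lp_mul_Lq_of_nonneg (Finset.range k) holderConjugate_four
    (f := fun _ => (1 : ℝ)) (g := fun i : ℕ => ‖((n + (i : ℤ) : ℤ) + a : ℂ)⁻¹‖)
    (fun _ _ => zero_le_one) (fun _ _ => norm_nonneg _)
  simp only [one_mul, Real.one_rpow, Finset.sum_const, Finset.card_range, nsmul_eq_mul,
    mul_one] at h1
  refine (norm_sum_le _ _).trans (h1.trans ?_)
  rw [mul_comm]
  refine mul_le_mul_of_nonneg_right (Real.rpow_le_rpow
    (Finset.sum_nonneg fun _ _ => by positivity) ?_ (by norm_num)) (by positivity)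
  have hs := hu.comp_injective (i := fun k : ℕ => n + (k : ℤ)) fun _ _ h => by simpa using h
  refine (hs.sum_le_tsum (Finset.range k) fun _ _ => Real.rpow_nonneg (norm_nonneg _) _).trans ?_
  exact tsum_comp_le_tsum_of_inj hu (fun m => by positivity)
    (i := fun k : ℕ => n + (k : ℤ)) fun _ _ h => by simpa using h

/-- Interchange of summation in `∑_n ∑_k e_k / (n + k + a)`: shifting `n` by `k` changes the partial
sums of the divergent series `∑ 1 / (n + a)` by two blocks of `k` terms, which tend to zero. -/
lemma tendsto_bilateral_sub {a : ℂ} {e : ℕ → ℂ}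
    (he : Summable fun k => ‖e k‖ * (k : ℝ) ^ (1 / 4 : ℝ)) (he' : Summable e)
    (hea : ∀ n : ℤ, Summable fun k : ℕ => e k * ((k : ℂ) + (n + a))⁻¹) :
    Tendsto (fun p => bilateralPartialSum (fun n => ∑' k : ℕ, e k * ((k : ℂ) + (n + a))⁻¹) p
      - (∑' k, e k) * bilateralPartialSum (fun n => ((n : ℂ) + a)⁻¹) p) atTop (𝓝 0) := by
  obtain ⟨C, hC⟩ := exists_norm_block_le a
  set W : ℕ → ℤ → ℂ := fun k n => ∑ i ∈ Finset.range k, ((n + (i : ℤ) : ℤ) + a : ℂ)⁻¹ with hW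
  have hWlim : ∀ k, Tendsto (W k) cofinite (𝓝 0) := fun k => by
    have hu : Tendsto (fun m : ℤ => ((m : ℂ) + a)⁻¹) cofinite (𝓝 0) := by
      have h := (summable_norm_inv_intCast_add a one_lt_two).tendsto_cofinite_zero.sqrt
      simp only [Real.rpow_two, Real.sqrt_sq (norm_nonneg _), Real.sqrt_zero] at h
      exact tendsto_zero_iff_norm_tendsto_zero.2 h
    have h : ∀ i ∈ Finset.range k,
        Tendsto (fun n : ℤ => ((n + (i : ℤ) : ℤ) + a : ℂ)⁻¹) cofinite (𝓝 0) := fun i _ =>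
      hu.comp (add_left_injective (i : ℤ)).tendsto_cofinite
    have h' := tendsto_finsetSum _ h
    rwa [Finset.sum_const_zero] at h'
  -- a shift by `k` changes a bilateral partial sum by the blocks of `k` terms at its two ends
  have hshift : ∀ (k : ℕ) (p : ℕ × ℕ),
      bilateralPartialSum (fun n => ((k : ℂ) + (n + a))⁻¹ - ((n : ℂ) + a)⁻¹) p
        = W k (p.2 + 1) - W k (-p.1) := fun k p => by
    have h := bilateralPartialSum_telescope (fun n => -W k n) p.1 p.2
    rw [show W k (p.2 + 1) - W k (-p.1) = -W k (-p.1) - -W k (p.2 + 1) by ring, ← h]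
    simp only [bilateralPartialSum]
    refine Finset.sum_congr rfl fun n _ => ?_
    have h1 := Finset.sum_range_sub (fun i : ℕ => ((n + (i : ℤ) : ℤ) + a : ℂ)⁻¹) k
    rw [Finset.sum_sub_distrib] at h1
    have h2 : ∀ i : ℕ, n + 1 + (i : ℤ) = n + ((i + 1 : ℕ) : ℤ) := fun i => by push_cast; ring
    simp only [hW, h2]
    have h3 : ((k : ℂ) + (n + a)) = ((n + (k : ℤ) : ℤ) : ℂ) + a := by push_cast; ring
    rw [h3]
    simp only [Nat.cast_zero, add_zero] at h1
    linear_combination -h1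
  have hterm : ∀ p : ℕ × ℕ,
      bilateralPartialSum (fun n => ∑' k : ℕ, e k * ((k : ℂ) + (n + a))⁻¹) p
        - (∑' k, e k) * bilateralPartialSum (fun n => ((n : ℂ) + a)⁻¹) p
      = ∑' k, e k * (W k (p.2 + 1) - W k (-p.1)) := fun p => by
    have h1 : ∀ n : ℤ, Summable fun k : ℕ => e k * (((k : ℂ) + (n + a))⁻¹ - ((n : ℂ) + a)⁻¹) :=
      fun n => ((hea n).sub (he'.mul_right ((n : ℂ) + a)⁻¹)).congr fun k => by ring
    have h2 := bilateralPartialSum_tsum h1 p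
    simp only [← hshift]
    have h3 : ∀ k, bilateralPartialSum
        (fun n => e k * (((k : ℂ) + (n + a))⁻¹ - ((n : ℂ) + a)⁻¹)) p
        = e k * bilateralPartialSum (fun n => ((k : ℂ) + (n + a))⁻¹ - ((n : ℂ) + a)⁻¹) p :=
      fun k => by simp only [bilateralPartialSum, Finset.mul_sum]
    simp only [h3] at h2
    rw [← h2]
    simp only [bilateralPartialSum, Finset.mul_sum, ← Finset.sum_sub_distrib]
    refine Finset.sum_congr rfl fun n _ => ?_
    rw [← tsum_mul_right, ← (hea n).tsum_sub (he'.mul_right _)]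
    exact tsum_congr fun k => by ring
  have key : Tendsto (fun p : ℕ × ℕ => ∑' k, e k * (W k (p.2 + 1) - W k (-p.1))) atTop
      (𝓝 (∑' _ : ℕ, (0 : ℂ))) := by
    refine tendsto_tsum_of_dominated_convergence (he.mul_left (2 * C)) (fun k => ?_)
      (Eventually.of_forall fun p k => ?_)
    · have h := (((hWlim k).comp tendsto_snd_add_one_cofinite).sub
        ((hWlim k).comp tendsto_neg_fst_cofinite)).const_mul (e k)
      simpa using h
    · rw [norm_mul]
      calc ‖e k‖ * ‖W k (p.2 + 1) - W k (-p.1)‖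
          ≤ ‖e k‖ * (C * (k : ℝ) ^ (1 / 4 : ℝ) + C * (k : ℝ) ^ (1 / 4 : ℝ)) := by
            gcongr
            exact (norm_sub_le _ _).trans (add_le_add (hC _ _) (hC _ _))
        _ = 2 * C * (‖e k‖ * (k : ℝ) ^ (1 / 4 : ℝ)) := by ring
  rw [tsum_zero] at key
  exact key.congr fun p => (hterm p).symm

/-! ### The series of the residues -/

lemma summable_residueCoeff_pow_four {q : ℕ} (hq : 1 ≤ q) (d : ℂ) :
    Summable fun k => ‖residueCoeff q d k‖ ^ (4 : ℝ) := by
  have hq' : (1 : ℝ) ≤ q := by exact_mod_cast hq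
  have h := (residueCoeff_isBigO q d).norm_left.rpow (r := 4) (by norm_num)
    (Eventually.of_forall fun k => by positivity)
  refine summable_of_isBigO_nat ((Real.summable_nat_rpow (p := (1 / 2 - q) * 4)).2 (by linarith))
    (h.congr_right fun k => ?_)
  rw [← Real.rpow_mul (by positivity)]

lemma summable_residueCoeff_mul_rpow {q : ℕ} (hq : 2 ≤ q) (d : ℂ) :
    Summable fun k : ℕ => ‖residueCoeff q d k‖ * (k : ℝ) ^ (1 / 4 : ℝ) := by
  have hq' : (2 : ℝ) ≤ q := by exact_mod_cast hq
  have h := (residueCoeff_isBigO q d).norm_left.mul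
    (Asymptotics.isBigO_refl (fun k : ℕ => (k : ℝ) ^ (1 / 4 : ℝ)) atTop)
  refine summable_of_isBigO_nat
    ((Real.summable_nat_rpow (p := (1 / 2 - q) + 1 / 4)).2 (by linarith))
    (h.trans_eventuallyEq ?_)
  filter_upwards [eventually_gt_atTop 0] with k hk
  rw [← Real.rpow_add (by exact_mod_cast hk)]

lemma norm_geom_sum_le {x : ℂ} (hx : ‖x‖ = 1) (hx1 : x ≠ 1) (n : ℕ) :
    ‖∑ i ∈ Finset.range n, x ^ (i + 1)‖ ≤ 2 / ‖x - 1‖ := by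
  have h : ∑ i ∈ Finset.range n, x ^ (i + 1) = x * ((x ^ n - 1) / (x - 1)) := by
    rw [← geom_sum_eq hx1, Finset.mul_sum]
    exact Finset.sum_congr rfl fun i _ => pow_succ' x i
  rw [h, norm_mul, hx, one_mul, norm_div]
  gcongr
  calc ‖x ^ n - 1‖ ≤ ‖x ^ n‖ + ‖(1 : ℂ)‖ := norm_sub_le _ _
    _ = 2 := by rw [norm_pow, hx]; norm_num

/-- For `q = 1` the series converges by Dirichlet's test, up to an absolutely convergent one. -/
lemma exists_tendsto_residueCoeff {q : ℕ} (hq : 1 ≤ q) {d x : ℂ} (hd : ∀ m : ℕ, d + (m + 1) ≠ 0)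
    (hx : ‖x‖ = 1) (hqx : ¬(q = 1 ∧ x = 1)) :
    ∃ S, Tendsto (fun K => ∑ k ∈ Finset.range K, residueCoeff q d k * x ^ k) atTop (𝓝 S) := by
  rcases Nat.lt_or_ge 1 q with h2 | h2
  · have h : Summable fun k => residueCoeff q d k * x ^ k := by
      refine Summable.of_norm ((summable_norm_residueCoeff h2 d).congr fun k => ?_)
      rw [norm_mul, norm_pow, hx, one_pow, mul_one]
    exact ⟨_, h.hasSum.tendsto_sum_nat⟩
  · obtain rfl : q = 1 := by omega
    have hx1 : x ≠ 1 := fun h => hqx ⟨rfl, h⟩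
    have hanti : Antitone fun k : ℕ => centralCoeff (k + 1) := fun i j h =>
      centralCoeff_antitone (by omega)
    obtain ⟨S₁, h1⟩ := cauchySeq_tendsto_of_complete
      (hanti.cauchySeq_series_mul_of_tendsto_zero_of_bounded
        ((tendsto_add_atTop_iff_nat 1).2 centralCoeff_tendsto) (norm_geom_sum_le hx hx1))
    have h2 : Summable fun k : ℕ =>
        d * ((centralCoeff (k + 1) : ℂ) / ((k + 1 : ℕ) + d)) * x ^ (k + 1) := by
      refine Summable.of_norm (((summable_nat_add_iff 1).2
        (summable_norm_centralCoeff_div d)).mul_left ‖d‖ |>.congr fun k => ?_)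
      rw [norm_mul, norm_mul, norm_pow, hx, one_pow, mul_one]
    refine ⟨S₁ - ∑' k : ℕ, d * ((centralCoeff (k + 1) : ℂ) / ((k + 1 : ℕ) + d)) * x ^ (k + 1),
      (tendsto_add_atTop_iff_nat 1).1 ((h1.sub h2.hasSum.tendsto_sum_nat).congr fun K => ?_)⟩
    rw [Finset.sum_range_succ', residueCoeff_zero, zero_mul, add_zero, ← Finset.sum_sub_distrib]
    refine Finset.sum_congr rfl fun k _ => ?_
    have h3 : ((k + 1 : ℕ) : ℂ) + d ≠ 0 := by
      have := hd k
      push_cast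
      rwa [add_comm]
    simp only [residueCoeff, pow_one, Complex.real_smul]
    field_simp
    ring

/-! ### Cyclotomic Hurwitz zeta functions as bilateral sums -/

lemma partialSum_eq (f : ℕ → ℂ) (N : ℕ) : partialSum f N = ∑ i ∈ Finset.range N, f (i + 1) := by
  induction N with
  | zero => simp [partialSum]
  | succ N ih =>
    rw [Finset.sum_range_succ, ← ih, partialSum, partialSum, Finset.sum_Icc_succ_top (by omega)]

lemma SeriesConverges.tendsto {f : ℕ → ℂ} (h : SeriesConverges f) :
    Tendsto (partialSum f) atTop (𝓝 (seriesValue f)) := by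
  obtain ⟨S, hS⟩ := h
  rwa [seriesValue, hS.limUnder_eq]

lemma seriesConverges_of_summable {f : ℕ → ℂ} (h : Summable fun i => f (i + 1)) :
    SeriesConverges f :=
  ⟨_, h.hasSum.tendsto_sum_nat.congr fun N => (partialSum_eq f N).symm⟩

lemma seriesConverges_hurwitzTerm {y c : ℂ} (hy : ‖y‖ = 1) (hc : ∀ n : ℤ, c ≠ n) {p : ℕ}
    (hp : 1 ≤ p) (hpy : ¬(p = 1 ∧ y = 1)) : SeriesConverges (hurwitzTerm p y c) := by
  have hy0 : y ≠ 0 := fun h => by simp [h] at hy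
  have hterm : ∀ i : ℕ, hurwitzTerm p y c (i + 1) = y ^ (i + 1) * ((i : ℂ) + c)⁻¹ ^ p := fun i => by
    rw [hurwitzTerm, inv_pow, div_eq_mul_inv]
    push_cast
    rw [show (i : ℂ) + 1 + c - 1 = i + c by ring]
  rcases Nat.lt_or_ge 1 p with h2 | h2
  · refine seriesConverges_of_summable ?_
    have h2' : (1 : ℝ) < p := by exact_mod_cast h2
    have h := (inv_natCast_add_isBigO c).norm_left.pow p
    have hs : Summable fun i : ℕ => ‖((i : ℂ) + c)⁻¹‖ ^ p := by
      refine summable_of_isBigO_nat ((Real.summable_nat_rpow (p := -p)).2 (by linarith))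
        (h.congr_right fun k => ?_)
      rw [← Real.rpow_natCast, ← Real.rpow_mul (by positivity), neg_one_mul]
    refine Summable.of_norm (hs.congr fun i => ?_)
    rw [hterm, norm_mul, norm_pow, norm_pow, hy, one_pow, one_mul]
  · obtain rfl : p = 1 := by omega
    have hy1 : y ≠ 1 := fun h => hpy ⟨rfl, h⟩
    have h1 : Tendsto (fun K : ℕ => boundaryTerm y c (K : ℤ)) atTop (𝓝 0) :=
      (tendsto_boundaryTerm (c := c) hy).comp (by
        rw [Int.cofinite_eq]
        exact tendsto_natCast_atTop_atTop.mono_right le_sup_right)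
    have h2 := ((summable_norm_partsTerm (c := c) hy).of_norm.comp_injective
      (i := fun k : ℕ => (k : ℤ)) Nat.cast_injective).hasSum.tendsto_sum_nat
    refine ⟨_, (((tendsto_const_nhds (x := boundaryTerm y c (0 : ℕ))).sub h1).sub h2).const_mul y
      |>.congr fun K => ?_⟩
    rw [partialSum_eq, ← Finset.sum_range_sub' (fun i : ℕ => boundaryTerm y c i),
      ← Finset.sum_sub_distrib, Finset.mul_sum]
    refine Finset.sum_congr rfl fun i _ => ?_
    have h3 := charTerm_eq hy hy1 hc i
    rw [hterm, Nat.cast_succ, Function.comp_apply, ← h3, charTerm]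
    simp only [zpow_natCast, Int.cast_natCast, pow_one]
    ring

/-- The terms `x^(-n) / (n + c)^p`, `n ∈ ℤ`. -/
def pairTerm (x c : ℂ) (p : ℕ) (n : ℤ) : ℂ := x ^ (-n) * ((n : ℂ) + c)⁻¹ ^ p

lemma bilateralPartialSum_pairTerm (x c : ℂ) (p M N : ℕ) (hx : x ≠ 0) :
    bilateralPartialSum (pairTerm x c p) (M, N)
      = x * partialSum (hurwitzTerm p x⁻¹ c) (N + 1)
        + (-1) ^ p * partialSum (hurwitzTerm p x (1 - c)) M := by
  rw [bilateralPartialSum_eq, partialSum_eq, partialSum_eq, Finset.mul_sum, Finset.mul_sum]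
  congr 1
  · refine Finset.sum_congr rfl fun i _ => ?_
    rw [pairTerm, hurwitzTerm, inv_pow, zpow_neg, zpow_natCast, Int.cast_natCast, inv_pow, pow_succ,
      show (((i + 1 : ℕ) : ℂ) + c - 1) = i + c by push_cast; ring]
    field_simp
  · refine Finset.sum_congr rfl fun i _ => ?_
    rw [pairTerm, hurwitzTerm, neg_neg, zpow_natCast,
      show (((-((i + 1 : ℕ) : ℤ) : ℤ) : ℂ) + c) = -((((i + 1 : ℕ) : ℂ) + (1 - c) - 1)) by
        push_cast; ring,
      inv_neg, neg_pow, inv_pow]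
    ring

lemma tendsto_pairTerm {x c : ℂ} (hx : ‖x‖ = 1) (hc : ∀ n : ℤ, c ≠ n) {k : ℕ}
    (hkx : ¬(k = 0 ∧ x = 1)) :
    Tendsto (bilateralPartialSum (pairTerm x c (k + 1))) atTop (𝓝 (cycHurwitzPair k x c)) := by
  have hx0 : x ≠ 0 := fun h => by simp [h] at hx
  have hc' : ∀ n : ℤ, 1 - c ≠ n := fun n h => hc (1 - n) (by push_cast; linear_combination -h)
  have h1 := (seriesConverges_hurwitzTerm (y := x⁻¹) (by rw [norm_inv, hx, inv_one]) hc
    (p := k + 1) (by omega) (fun h => hkx ⟨by omega, inv_eq_one.1 h.2⟩)).tendsto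
  have h2 := (seriesConverges_hurwitzTerm hx hc' (p := k + 1) (by omega)
    (fun h => hkx ⟨by omega, h.2⟩)).tendsto
  have h : Tendsto (fun p : ℕ × ℕ => x * partialSum (hurwitzTerm (k + 1) x⁻¹ c) (p.2 + 1)
      + (-1) ^ (k + 1) * partialSum (hurwitzTerm (k + 1) x (1 - c)) p.1) atTop
      (𝓝 (x * cycHurwitz (k + 1) x⁻¹ c + (-1) ^ (k + 1) * cycHurwitz (k + 1) x (1 - c))) := by
    rw [← prod_atTop_atTop_eq]
    exact (((h1.comp (tendsto_add_atTop_nat 1)).comp tendsto_snd).const_mul x).add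
      ((h2.comp tendsto_fst).const_mul _)
  have hval : cycHurwitzPair k x c
      = x * cycHurwitz (k + 1) x⁻¹ c + (-1) ^ (k + 1) * cycHurwitz (k + 1) x (1 - c) := by
    rw [cycHurwitzPair, if_neg hkx]
    ring
  rw [hval]
  exact h.congr fun p => (bilateralPartialSum_pairTerm x c (k + 1) p.1 p.2 hx0).symm

lemma seriesConverges_hurwitz_sub (c : ℂ) (hc : ∀ n : ℤ, c ≠ n) :
    SeriesConverges fun n => hurwitzTerm 1 1 c n - hurwitzTerm 1 1 (1 - c) n := by
  refine seriesConverges_of_summable ?_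
  have h := ((summable_inv_mul_inv c (1 - c)).of_norm.comp_injective
    (i := fun k : ℕ => (k : ℤ)) Nat.cast_injective).mul_left (1 - 2 * c)
  refine h.congr fun i => ?_
  have h1 : (i : ℂ) + c ≠ 0 := fun h => hc (-i) (by push_cast; linear_combination h)
  have h2 : (i : ℂ) + (1 - c) ≠ 0 := fun h => hc (i + 1) (by push_cast; linear_combination -h)
  simp only [hurwitzTerm, one_pow, pow_one, Function.comp_apply, Int.cast_natCast]
  rw [show ((i + 1 : ℕ) : ℂ) + c - 1 = i + c by push_cast; ring,
    show ((i + 1 : ℕ) : ℂ) + (1 - c) - 1 = i + (1 - c) by push_cast; ring]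
  field_simp
  ring

/-- For `k = 0` and `x = 1` the bilateral series converges along the partial sums from `-(M + 1)` to
`M`, to the value obtained by taking the difference term by term. -/
lemma tendsto_pairTerm_one {c : ℂ} (hc : ∀ n : ℤ, c ≠ n) :
    Tendsto (fun M : ℕ => bilateralPartialSum (pairTerm 1 c 1) (M + 1, M)) atTop
      (𝓝 (cycHurwitzPair 0 1 c)) := by
  have h := (seriesConverges_hurwitz_sub c hc).tendsto.comp (tendsto_add_atTop_nat 1)
  rw [cycHurwitzPair, if_pos ⟨rfl, rfl⟩]
  refine h.congr fun M => ?_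
  rw [bilateralPartialSum_pairTerm _ _ _ _ _ one_ne_zero, Function.comp_apply]
  simp only [partialSum, Finset.sum_sub_distrib, inv_one]
  ring

lemma tendsto_pairTerm_one_sub {a b : ℂ} (ha : ∀ n : ℤ, a ≠ n) (hb : ∀ n : ℤ, b ≠ n) :
    Tendsto (fun p => bilateralPartialSum (pairTerm 1 b 1) p
      - bilateralPartialSum (pairTerm 1 a 1) p) atTop
      (𝓝 (cycHurwitzPair 0 1 b - cycHurwitzPair 0 1 a)) := by
  have hs : Summable fun n : ℤ => pairTerm 1 b 1 n - pairTerm 1 a 1 n := by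
    refine ((summable_inv_mul_inv a b).of_norm.mul_left (a - b)).congr fun n => ?_
    have h1 : (n : ℂ) + a ≠ 0 := fun h => ha (-n) (by push_cast; linear_combination h)
    have h2 : (n : ℂ) + b ≠ 0 := fun h => hb (-n) (by push_cast; linear_combination h)
    simp only [pairTerm, one_zpow, pow_one, one_mul]
    field_simp
    ring
  have h1 := tendsto_bilateralPartialSum hs
  have h2 : ∀ p, bilateralPartialSum (fun n => pairTerm 1 b 1 n - pairTerm 1 a 1 n) p
      = bilateralPartialSum (pairTerm 1 b 1) p - bilateralPartialSum (pairTerm 1 a 1) p := fun p =>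
    Finset.sum_sub_distrib _ _
  have hdiag : Tendsto (fun M : ℕ => (M + 1, M)) atTop (atTop : Filter (ℕ × ℕ)) := by
    rw [← prod_atTop_atTop_eq]
    exact (tendsto_add_atTop_nat 1).prodMk tendsto_id
  have h3 := (tendsto_pairTerm_one hb).sub (tendsto_pairTerm_one ha)
  have h4 := h1.comp hdiag
  rw [← tendsto_nhds_unique (h4.congr fun M => h2 _) h3]
  exact h1.congr h2

/-! ### The bilateral Apéry-like series -/

lemma centralBinomTerm_eq (q : ℕ) (x c : ℂ) (n : ℕ) :
    centralBinomTerm q x c n = residueCoeff q c n * x ^ n := by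
  simp only [centralBinomTerm, residueCoeff, centralCoeff, Nat.centralBinom_eq_two_mul_choose]
  push_cast
  rw [← mul_div_assoc, div_div, mul_comm (4 ^ n : ℂ)]

lemma tendsto_centralBinomTerm {q : ℕ} {x c S : ℂ}
    (h : Tendsto (fun K => ∑ k ∈ Finset.range K, residueCoeff q c k * x ^ k) atTop (𝓝 S)) :
    Tendsto (partialSum (centralBinomTerm q x c)) atTop (𝓝 S) := by
  refine (h.comp (tendsto_add_atTop_nat 1)).congr fun N => ?_
  rw [partialSum_eq, Function.comp_apply, Finset.sum_range_succ', residueCoeff_zero, zero_mul,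
    add_zero]
  exact Finset.sum_congr rfl fun i _ => (centralBinomTerm_eq q x c (i + 1)).symm

/-- Each term of the bilateral series, expanded by the Taylor formula at `a - b` with remainder. -/
lemma aperyTerm_eq {x a b : ℂ} {q : ℕ} (ha : ∀ n : ℤ, a ≠ n) (hb : ∀ n : ℤ, b ≠ n)
    (hd : ∀ m : ℕ, a - b + (m + 1) ≠ 0) (n : ℤ) :
    aperyTerm (q + 1) x a b n
      = ∑ j ∈ Finset.range (q + 1), recipTaylor (a - b) j * pairTerm x b (q - j + 1) n
        - (-1) ^ (q + 1)
          * (x ^ (-n) * ∑' k : ℕ, residueCoeff (q + 1) (a - b) k * ((k : ℂ) + (n + a))⁻¹) := by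
  have hz : ∀ m : ℕ, (n : ℂ) + a + (m + 1) ≠ 0 := fun m h =>
    ha (-n - m - 1) (by push_cast; linear_combination h)
  have hu : (n : ℂ) + b ≠ 0 := fun h => hb (-n) (by push_cast; linear_combination h)
  have hsum : a - b + ((n : ℂ) + b) = n + a := by ring
  have h1 := recipSeries_taylor hd (u := (n : ℂ) + b) (by simpa only [hsum] using hz)
    (q := q + 1) (by omega)
  have h2 : aperyTerm (q + 1) x a b n
      = recipSeries (n + a) * (((n : ℂ) + b) ^ (q + 1))⁻¹ * x ^ (-n) := by
    rw [recipSeries_eq hz, aperyTerm, genBinom,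
      show 2 * (n : ℂ) + 2 * a - (n + a) + 1 = n + a + 1 by ring,
      show 2 * ((n : ℂ) + a) + 1 = 2 * n + 2 * a + 1 by ring]
    simp only [div_eq_mul_inv, mul_inv, inv_inv]
    ring
  rw [hsum] at h1
  rw [h2, h1, taylorRemainder, hsum, sub_mul, sub_mul, Finset.sum_mul, Finset.sum_mul]
  congr 1
  · refine Finset.sum_congr rfl fun j hj => ?_
    have hj' : j + (q - j + 1) = q + 1 := by
      have := Finset.mem_range.1 hj
      omega
    rw [pairTerm, ← hj', pow_add, inv_pow]
    field_simp
  · field_simp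

/-- The sum of the bilateral series. For `x ≠ 1` the Taylor part and the remainder part converge
separately. For `x = 1` the divergent sums `∑ 1 / (n + b)` and `∑ 1 / (n + a)` in them carry the
same coefficient, up to sign, and combine to a convergent one. -/
lemma tendsto_aperyTerm {x a b S : ℂ} {q : ℕ} (hx : ‖x‖ = 1) (ha : ∀ n : ℤ, a ≠ n)
    (hb : ∀ n : ℤ, b ≠ n) (hd : ∀ m : ℕ, a - b + (m + 1) ≠ 0) (hqx : ¬(q + 1 = 1 ∧ x = 1))
    (hS : Tendsto (fun K => ∑ k ∈ Finset.range K, residueCoeff (q + 1) (a - b) k * x ^ k) atTop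
      (𝓝 S)) :
    Tendsto (bilateralPartialSum (aperyTerm (q + 1) x a b)) atTop
      (𝓝 (∑ j ∈ Finset.range (q + 1), recipTaylor (a - b) j * cycHurwitzPair (q - j) x b
        - (-1) ^ (q + 1) * (cycHurwitzPair 0 x a * S))) := by
  set R : ℤ → ℂ := fun n =>
    x ^ (-n) * ∑' k : ℕ, residueCoeff (q + 1) (a - b) k * ((k : ℂ) + (n + a))⁻¹ with hR
  have hsplit : ∀ p, bilateralPartialSum (aperyTerm (q + 1) x a b) p
      = ∑ j ∈ Finset.range (q + 1),
          recipTaylor (a - b) j * bilateralPartialSum (pairTerm x b (q - j + 1)) p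
        - (-1) ^ (q + 1) * bilateralPartialSum R p := fun p => by
    simp only [bilateralPartialSum, Finset.mul_sum]
    rw [Finset.sum_comm, ← Finset.sum_sub_distrib]
    exact Finset.sum_congr rfl fun n _ => aperyTerm_eq ha hb hd n
  rw [tendsto_congr hsplit]
  by_cases hx1 : x = 1
  · subst hx1
    have hq : 1 ≤ q := by
      by_contra hcon
      exact hqx ⟨by omega, rfl⟩
    have hsum := (summable_norm_residueCoeff (s := q + 1) (by omega) (a - b)).of_norm
    have hSe : S = ∑' k, residueCoeff (q + 1) (a - b) k := by
      simp only [one_pow, mul_one] at hS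
      exact tendsto_nhds_unique hS hsum.hasSum.tendsto_sum_nat
    -- the coefficients of `∑ 1 / (n + b)` and `∑ 1 / (n + a)` are opposite to each other
    have hlast : recipTaylor (a - b) q = (-1) ^ (q + 1) * S := by
      obtain ⟨r, rfl⟩ : ∃ r, q = r + 1 := ⟨q - 1, by omega⟩
      simp [recipTaylor, hSe, pow_succ]
    have h0 := tendsto_bilateral_sub (a := a) (summable_residueCoeff_mul_rpow (by omega) (a - b))
      hsum (fun n => summable_residueCoeff_mul_inv (by omega) (a - b) (n + a))
    have h1 := tendsto_pairTerm_one_sub ha hb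
    have h2 : ∀ j ∈ Finset.range q, Tendsto (fun p => recipTaylor (a - b) j
        * bilateralPartialSum (pairTerm 1 b (q - j + 1)) p) atTop
        (𝓝 (recipTaylor (a - b) j * cycHurwitzPair (q - j) 1 b)) := fun j hj => by
      have := Finset.mem_range.1 hj
      exact (tendsto_pairTerm hx hb (by omega)).const_mul _
    have h := ((tendsto_finsetSum _ h2).add (h1.const_mul (recipTaylor (a - b) q))).sub
      (h0.const_mul ((-1) ^ (q + 1)))
    have hlim : ∑ j ∈ Finset.range (q + 1), recipTaylor (a - b) j * cycHurwitzPair (q - j) 1 b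
        - (-1) ^ (q + 1) * (cycHurwitzPair 0 1 a * S)
        = ∑ j ∈ Finset.range q, recipTaylor (a - b) j * cycHurwitzPair (q - j) 1 b
          + recipTaylor (a - b) q * (cycHurwitzPair 0 1 b - cycHurwitzPair 0 1 a)
          - (-1) ^ (q + 1) * 0 := by
      rw [Finset.sum_range_succ, hlast, Nat.sub_self]
      ring
    rw [hlim]
    refine h.congr fun p => ?_
    have hR1 : bilateralPartialSum R p = bilateralPartialSum
        (fun n => ∑' k : ℕ, residueCoeff (q + 1) (a - b) k * ((k : ℂ) + (n + a))⁻¹) p := by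
      simp [hR, bilateralPartialSum]
    have ha1 : bilateralPartialSum (fun n => ((n : ℂ) + a)⁻¹) p
        = bilateralPartialSum (pairTerm 1 a 1) p := by
      simp [pairTerm, bilateralPartialSum]
    rw [Finset.sum_range_succ, hR1, ha1, ← hSe, hlast, Nat.sub_self, zero_add]
    ring
  · have hL : Tendsto (bilateralPartialSum (charTerm x⁻¹ a)) atTop (𝓝 (cycHurwitzPair 0 x a)) := by
      refine (tendsto_pairTerm hx ha (k := 0) (fun h => hx1 h.2)).congr fun p => ?_
      simp only [bilateralPartialSum]
      exact Finset.sum_congr rfl fun n _ => by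
        rw [pairTerm, charTerm, zero_add, pow_one, inv_zpow, zpow_neg]
    have h1 := tendsto_bilateral_of_ne_one hx hx1 ha
      (summable_residueCoeff_pow_four (by omega) (a - b)) hS hL
    have h2 : ∀ j ∈ Finset.range (q + 1), Tendsto (fun p => recipTaylor (a - b) j
        * bilateralPartialSum (pairTerm x b (q - j + 1)) p) atTop
        (𝓝 (recipTaylor (a - b) j * cycHurwitzPair (q - j) x b)) := fun j _ =>
      (tendsto_pairTerm hx hb (fun h => hx1 h.2)).const_mul _
    exact (tendsto_finsetSum _ h2).sub (h1.const_mul _)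

end AperyLike

end

theorem mainTheorem2 (x a b : ℂ) (q : ℕ)
    (hx : ∃ m : ℕ, 0 < m ∧ x ^ m = 1)
    (ha : ∀ n : ℤ, a ≠ n) (hb : ∀ n : ℤ, b ≠ n)
    (hq : 1 ≤ q)
    (hba : ∀ n : ℕ, 1 ≤ n → b - a ≠ n) (hba2 : ∀ n : ℕ, 1 ≤ n → 2 * (b - a) ≠ n)
    (hqx : ¬ (q = 1 ∧ x = 1)) :
    -- all the series that occur converge
    AperyLike.BilateralConverges (AperyLike.aperyTerm q x a b) ∧
    AperyLike.SeriesConverges (AperyLike.centralBinomTerm q x (a - b)) ∧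
    (∀ c : ℂ, (c = a ∨ c = b) → ∀ p : ℕ, 1 ≤ p → ¬ (p = 1 ∧ x = 1) →
      AperyLike.SeriesConverges (AperyLike.hurwitzTerm p x⁻¹ c) ∧
      AperyLike.SeriesConverges (AperyLike.hurwitzTerm p x (1 - c))) ∧
    (∀ c : ℂ, (c = a ∨ c = b) → AperyLike.SeriesConverges
      (fun n => AperyLike.hurwitzTerm 1 1 c n - AperyLike.hurwitzTerm 1 1 (1 - c) n)) ∧
    -- the identity
    AperyLike.bilateralValue (AperyLike.aperyTerm q x a b)
        - (-1) ^ q * (-AperyLike.cycHurwitzPair 0 x a)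
          * AperyLike.seriesValue (AperyLike.centralBinomTerm q x (a - b))
      = (4 : ℂ) ^ (a - b) * ∑ k ∈ Finset.Nat.antidiagonalTuple 5 (q - 1),
          AperyLike.coeffC (k 0) (a - b) * AperyLike.coeffC (k 1) (a - b)
            * AperyLike.coeffD (k 2) (2 * a - 2 * b) * 2 ^ (k 2 + k 3)
            / (((k 0).factorial : ℂ) * ((k 1).factorial : ℂ) * ((k 2).factorial : ℂ)
                * ((k 3).factorial : ℂ))
            * (Real.log 2 : ℂ) ^ (k 3)
            * AperyLike.cycHurwitzPair (k 4) x b := by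
  obtain ⟨m, hm, hxm⟩ := hx
  have hxn : ‖x‖ = 1 := Complex.norm_eq_one_of_pow_eq_one hxm hm.ne'
  obtain ⟨Q, rfl⟩ : ∃ Q, q = Q + 1 := ⟨q - 1, by omega⟩
  have hd : ∀ m : ℕ, a - b + (m + 1) ≠ 0 := fun m h =>
    hba (m + 1) (by omega) (by push_cast; linear_combination -h)
  have h2d : ∀ m : ℕ, 2 * (a - b) + (m + 1) ≠ 0 := fun m h =>
    hba2 (m + 1) (by omega) (by push_cast; linear_combination -h)
  obtain ⟨S, hS⟩ := AperyLike.exists_tendsto_residueCoeff hq hd hxn hqx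
  have hcentral := AperyLike.tendsto_centralBinomTerm hS
  have hmain := AperyLike.tendsto_aperyTerm hxn ha hb hd hqx hS
  have hint : ∀ c : ℂ, (c = a ∨ c = b) → ∀ n : ℤ, c ≠ n := by
    rintro c (rfl | rfl)
    exacts [ha, hb]
  refine ⟨⟨_, hmain⟩, ⟨S, hcentral⟩, fun c hc p hp hpx => ⟨?_, ?_⟩, fun c hc =>
    AperyLike.seriesConverges_hurwitz_sub c (hint c hc), ?_⟩
  · exact AperyLike.seriesConverges_hurwitzTerm (by rw [norm_inv, hxn, inv_one]) (hint c hc) hp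
      fun h => hpx ⟨h.1, inv_eq_one.1 h.2⟩
  · exact AperyLike.seriesConverges_hurwitzTerm hxn
      (fun n h => hint c hc (1 - n) (by push_cast; linear_combination -h)) hp hpx
  · have h2ab : 2 * a - 2 * b = 2 * (a - b) := by ring
    have hconv := AperyLike.recipTaylor_convolution hd h2d
      (fun j => AperyLike.cycHurwitzPair j x b) Q
    have hconv := AperyLike.recipTaylor_convolution hd h2d
      (fun j => AperyLike.cycHurwitzPair j x b) Q
    have hconv := AperyLike.recipTaylor_convolution hd h2d
      (fun j => AperyLike.cycHurwitzPair j x b) Q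
    rw [AperyLike.bilateralValue, hmain.limUnder_eq, AperyLike.seriesValue, hcentral.limUnder_eq,
      h2ab, Nat.add_sub_cancel, ← hconv]
    ring
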